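/- Let $\alpha<\beta<1$ be real numbers with $\beta\notin\mathbb Z$, and let $c,z\in\mathbb C$ satisfy $0<|c|<1$, $|\arg c|<\pi$ and $\Re z\ge 0$. Here ${}_2F_1$ is the Gauss hypergeometric function, $1/\Gamma$ is the entire reciprocal Gamma function, powers have their principal values, and, for $b\notin\mathbb Z$, $U$ is Tricomi's confluent hypergeometric function $$U(a,b;w)=\frac{\pi}{\sin(\pi b)}\left(\frac{{}_1F_1(a;b;w)}{\Gamma(b)\Gamma(1+a-b)}-\frac{w^{1-b}\,{}_1F_1(1+a-b;2-b;w)}{\Gamma(a)\Gamma(2-b)}\right),$$ regarded as a function on the Riemann surface of the logarithm, so that $w^{1-b}=e^{(1-b)(\ln|w|+i\arg w)}$ depends on the choice of $\arg w$. Then $$\int_0^\infty\frac{(t+c)^{\alpha}\,t^{\beta-\alpha-1}}{1+t}\,e^{-zt}\,dt=\frac{\pi}{\sin(\pi\beta)}\left((1-c)^{\alpha}-\frac{\Gamma(\beta-\alpha)}{\Gamma(-\alpha)\Gamma(1+\beta)}\,{}_2F_1(1,\beta-\alpha;1+\beta;c)\,c^{\beta}\right)e^{z}-\Gamma(\beta-\alpha)\,z^{1-\beta}\int_0^1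 e^{zt}\,U\bigl(-\alpha,1-\beta;cz(1-t)\bigr)(1-t)^{-\beta}\,dt ,$$ where in the argument of $U$ one takes $\arg\bigl(cz(1-t)\bigr)=\arg c+\arg z$ with the principal arguments of $c$ and $z$ (so $U$ has its principal value whenever $-\pi<\arg c+\arg z\le\pi$), and where for $z=0$ the last term is read as $0$. The integral on the left converges absolutely, and so does the integral on the right for $z\ne0$. -/

import Mathlib

open Complex MeasureTheory Set

/-- Tricomi's confluent hypergeometric function `U(a, b; w)` for `b ∉ ℤ`, as a function of the
logarithm `ζ` of its argument, i.e. on the Riemann surface of the logarithm: with `w = e ^ ζ` and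
`w ^ (1 - b) = e ^ ((1 - b) ζ)`,
`U = π / sin (π b) * (₁F₁(a; b; w) / (Γ(b) Γ(1 + a - b))
      - w ^ (1 - b) ₁F₁(1 + a - b; 2 - b; w) / (Γ(a) Γ(2 - b)))`.
Here `regularizedHGFun {a} {b} w` is `₁F₁(a; b; w) / Γ(b)`, and `1 / Γ` is `0` at the poles of `Γ`,
in agreement with the values of `Complex.Gamma` and of division there. -/
noncomputable def kummerULog (a b ζ : ℂ) : ℂ :=
  (Real.pi : ℂ) / Complex.sin (Real.pi * b) *
    (regularizedHGFun {a} {b} (Complex.exp ζ) / Complex.Gamma (1 + a - b)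
      - Complex.exp ((1 - b) * ζ) *
          regularizedHGFun {1 + a - b} {2 - b} (Complex.exp ζ) / Complex.Gamma a)

/-- The principal branch of Tricomi's function `U(a, b; w)`, for `b ∉ ℤ` and `w ≠ 0`. -/
noncomputable def kummerU (a b w : ℂ) : ℂ :=
  kummerULog a b (Complex.log w)

/-- The coefficient of `e ^ z` in the closed form:
`π / sin (π β) * ((1 - c) ^ α - Γ(β - α) / (Γ(-α) Γ(1 + β)) * ₂F₁(1, β - α; 1 + β; c) * c ^ β)`. -/
noncomputable def expCoefficient (α β : ℝ) (c : ℂ) : ℂ :=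
  (Real.pi : ℂ) / Complex.sin (Real.pi * β) *
    ((1 - c) ^ (α : ℂ)
      - Complex.Gamma (β - α) / (Complex.Gamma (-α) * Complex.Gamma (1 + β)) *
          ordinaryHypergeometric (1 : ℂ) (β - α : ℂ) (1 + β : ℂ) c * c ^ (β : ℂ))

/-! Put a = α, g = β − α, b = a + g = β and K(t) = (t + c)^a t^(g−1), and let L(z) = ∫ K(t) e^(−zt)
dt and S(z) = ∫ K(t) e^(−zt)/(1 + t) dt. Differentiating e^(−z) S(z) brings down −(1 + t), which
cancels the denominator: (e^(−z) S)' = −e^(−z) L. Integrating along the segment from 0 to z gives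
S(z) = e^z S(0) − z ∫₀¹ e^(zt) L((1 − t) z) dt, so it remains to evaluate L and S(0).

Evaluation of L (`laplacePow_eq`). Each derivative of L raises g by one, up to sign, and integration
by parts is Kummer's differential equation. For 0 < b < 1 the difference D between L and the
expected combination `kummerLaplace` of the two Kummer solutions satisfies D → 0 and s D' → 0 as s →
0+. Its Wronskians with both solutions therefore vanish, while their mutual Wronskian does not, so D
= 0. Smaller b are reached by integrating the identity for g + 1, with Euler's Beta integral as
value at 0, and complex s by the identity theorem. Read on the logarithmic surface, the combination
is Tricomi's U (`kummerLaplace_eq_kummerULog`).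

Evaluation of S(0) (`stieltjesPow_eq`). As a function of c, S(0) satisfies a linear differential
equation of first order, and so does `expCoefficient`, because the upper parameter 1 of ₂F₁ makes
its equation first order. For 0 < b < 1 both tend to π / sin(πb) as c → 0 along a ray, so they
agree. Smaller b follow from 1/(1 + t) = 1 − t/(1 + t).

The integration along the segment is carried out for Re z > 0 (`stieltjesLaplace_eq_of_re_pos`), and
continuity in z extends the result to the imaginary axis. -/

open Filter Topology

/-! ### Power series of the Kummer and Gauss functions. -/

/-- A power series convergent on a disc may be differentiated termwise. -/
theorem hasDerivAt_tsum_mul_pow {a : ℕ → ℂ} {R : ℝ}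
    (ha : ∀ x : ℂ, ‖x‖ < R → Summable fun n => ‖a n * x ^ n‖) {x : ℂ} (hx : ‖x‖ < R) :
    ∃ d : ℂ, HasDerivAt (fun x => ∑' n, a n * x ^ n) d x ∧
      HasSum (fun n : ℕ => a (n + 1) * (n + 1) * x ^ n) d := by
  obtain ⟨r, hxr, hrR⟩ := exists_between hx
  obtain ⟨r', hrr, hrR'⟩ := exists_between hrR
  have hr : 0 ≤ r := (norm_nonneg x).trans hxr.le
  have hr' : 0 < r' := hr.trans_lt hrr
  have hs := ha (r' : ℂ) (by simpa [abs_of_pos hr'] using hrR')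
  have hbd : Summable fun n : ℕ => ‖a n‖ * (n * r ^ (n - 1)) := by
    have h1 : Tendsto (fun n : ℕ => (n : ℝ) * (r / r') ^ n) atTop (𝓝 0) :=
      tendsto_self_mul_const_pow_of_lt_one (by positivity) (by rw [div_lt_one hr']; exact hrr)
    rcases hr.eq_or_lt with h0 | h0
    · apply summable_of_ne_finset_zero (s := Finset.range 2)
      intro n hn
      simp only [Finset.mem_range, not_lt] at hn
      rw [← h0, zero_pow (by omega)]
      simp
    -- The threshold is r itself: n (r/r')^n < r is the same as n r^(n−1) < r'^n, which compares
    -- with the convergent series at r'.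
    · obtain ⟨N, hN⟩ := (h1.eventually (gt_mem_nhds h0)).exists_forall_of_atTop
      rw [← summable_nat_add_iff N]
      rw [← summable_nat_add_iff N] at hs
      refine Summable.of_nonneg_of_le (fun n => by positivity) (fun n => ?_) hs
      have h2 := hN (n + N) (by omega)
      rw [norm_mul, norm_pow, norm_real, Real.norm_of_nonneg hr'.le]
      refine mul_le_mul_of_nonneg_left ?_ (norm_nonneg _)
      rcases Nat.eq_zero_or_pos (n + N) with h3 | h3
      · simp [h3]
      obtain ⟨m, hm⟩ : ∃ m, n + N = m + 1 := ⟨n + N - 1, by omega⟩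
      rw [hm] at h2 ⊢
      rw [div_pow, mul_div_assoc', div_lt_iff₀ (by positivity), pow_succ r, ← mul_assoc, mul_comm r] at h2
      exact (lt_of_mul_lt_mul_right h2 h0.le).le
  have hd := hasDerivAt_tsum_of_isPreconnected (𝕜 := ℂ) (g := fun (n : ℕ) (y : ℂ) => a n * y ^ n)
    (g' := fun (n : ℕ) (y : ℂ) => a n * (n * y ^ (n - 1))) (t := Metric.ball (0 : ℂ) r)
    (y₀ := x) (y := x) hbd Metric.isOpen_ball (convex_ball (0 : ℂ) r).isPreconnected
    (fun n y _ => (hasDerivAt_pow n y).const_mul (a n))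
    (fun n y hy => by
      rw [norm_mul, norm_mul, norm_pow, norm_natCast]
      have : ‖y‖ ≤ r := by simpa using (mem_ball_zero_iff.1 hy).le
      gcongr)
    (by simpa using hxr) ((ha x hx).of_norm) (by simpa using hxr)
  refine ⟨_, hd, ?_⟩
  have hsum : Summable fun n : ℕ => a n * (n * x ^ (n - 1)) := by
    refine Summable.of_norm_bounded hbd fun n => ?_
    rw [norm_mul, norm_mul, norm_pow, norm_natCast]
    gcongr
  have h := (hasSum_nat_add_iff' 1).2 hsum.hasSum
  simp only [Finset.sum_range_one, Nat.cast_zero, zero_mul, mul_zero, sub_zero] at h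
  refine h.congr_fun fun n => ?_
  push_cast
  ring

theorem regularizedHGFun_hasSum (a b w : ℂ) :
    HasSum (fun n : ℕ => (ascPochhammer ℂ n).eval a / (n.factorial * Gamma (b + n)) * w ^ n)
      (regularizedHGFun {a} {b} w) := by
  have h := (regularizedHGFunSeries {a} {b}).hasSum (x := w) (by
    rw [radius_regularizedHGFunSeries_eq_top (by simp)]; simp)
  unfold regularizedHGFun
  refine h.congr_fun fun n => ?_
  simp [regularizedHGFunSeries, regularizedHGFunCoeff, mul_comm]

/-- There is no exceptional b, since both sides are 0 at the poles of Γ. This allows the factors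
1/Γ(−a) to be handled uniformly, including nonnegative integers a. -/
theorem Gamma_inv_step (b : ℂ) : (Gamma b)⁻¹ = b * (Gamma (b + 1))⁻¹ := by
  by_cases hb : b = 0
  · simp [hb]
  · rw [Gamma_add_one b hb]
    field_simp

theorem ascPochhammer_eval_add_one (a : ℂ) (n : ℕ) :
    a * (ascPochhammer ℂ n).eval (a + 1) = (ascPochhammer ℂ n).eval a * (a + n) := by
  have h1 : (ascPochhammer ℂ (n + 1)).eval a = a * (ascPochhammer ℂ n).eval (a + 1) := by
    rw [ascPochhammer_succ_left]; simp
  rw [← h1, ascPochhammer_succ_eval]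

/-- The common term w a M(a + 1, b + 1) is θM with θ = w d/dw, so it multiplies the n-th coefficient
by n. Then θ + b − 1 lowers b and θ + a raises a. Every differential equation for Kummer functions
below is a combination of these two relations. -/
theorem regularizedHGFun_contiguous (a b w : ℂ) :
    w * (a * regularizedHGFun {a + 1} {b + 1} w) + (b - 1) * regularizedHGFun {a} {b} w =
        regularizedHGFun {a} {b - 1} w ∧
      w * (a * regularizedHGFun {a + 1} {b + 1} w) + a * regularizedHGFun {a} {b} w =
        a * regularizedHGFun {a + 1} {b} w := by
  have h1 := regularizedHGFun_hasSum (a + 1) (b + 1) w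
  have h2 := regularizedHGFun_hasSum a b w
  have h3 := regularizedHGFun_hasSum a (b - 1) w
  have h4 := regularizedHGFun_hasSum (a + 1) b w
  have h5 : HasSum (fun n : ℕ => n * ((ascPochhammer ℂ n).eval a /
      (n.factorial * Gamma (b + n)) * w ^ n)) (w * (a * regularizedHGFun {a + 1} {b + 1} w)) := by
    rw [← hasSum_nat_add_iff' 1]
    simp only [Finset.sum_range_one, Nat.cast_zero, zero_mul, sub_zero]
    refine ((h1.mul_left a).mul_left w).congr_fun fun n => ?_
    have e1 := ascPochhammer_eval_add_one a n
    have e2 : (n.factorial : ℂ) ≠ 0 := by exact_mod_cast n.factorial_ne_zero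
    have e3 : (n : ℂ) + 1 ≠ 0 := by exact_mod_cast n.succ_ne_zero
    rw [ascPochhammer_succ_eval, ← e1, Nat.factorial_succ]
    push_cast
    rw [show b + 1 + (n : ℂ) = b + (n + 1) by ring, pow_succ]
    field_simp
  constructor
  · refine ((h5.add (h2.mul_left (b - 1))).unique (h3.congr_fun fun n => ?_))
    have e := Gamma_inv_step (b - 1 + n)
    rw [show b - 1 + (n : ℂ) + 1 = b + n by ring] at e
    rw [div_mul_eq_div_div _ _ (Gamma (b - 1 + n)), div_mul_eq_div_div _ _ (Gamma (b + n)),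
      div_eq_mul_inv _ (Gamma (b - 1 + n)), e]
    ring
  · refine ((h5.add (h2.mul_left a)).unique ((h4.mul_left a).congr_fun fun n => ?_))
    have e1 := ascPochhammer_eval_add_one a n
    linear_combination (-(1 / ((n.factorial : ℂ) * Gamma (b + n))) * w ^ n) * e1

theorem regularizedHGFun_hasDerivAt (a b w : ℂ) :
    HasDerivAt (regularizedHGFun {a} {b}) (a * regularizedHGFun {a + 1} {b + 1} w) w := by
  have hR : ‖w‖ < ‖w‖ + 1 := by linarith
  obtain ⟨d, hd, hs⟩ := hasDerivAt_tsum_mul_pow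
    (a := fun n => (ascPochhammer ℂ n).eval a / (n.factorial * Gamma (b + n)))
    (fun x _ => (regularizedHGFun_hasSum a b x).summable.norm) hR
  have he : regularizedHGFun {a} {b} = fun x => ∑' n : ℕ,
      (ascPochhammer ℂ n).eval a / (n.factorial * Gamma (b + n)) * x ^ n := by
    funext x
    exact (regularizedHGFun_hasSum a b x).tsum_eq.symm
  rw [he]
  convert hd using 1
  refine ((regularizedHGFun_hasSum (a + 1) (b + 1) w).mul_left a).unique (hs.congr_fun fun n => ?_)
  have e1 := ascPochhammer_eval_add_one a n
  have e2 : (n.factorial : ℂ) ≠ 0 := by exact_mod_cast n.factorial_ne_zero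
  have e3 : (n : ℂ) + 1 ≠ 0 := by exact_mod_cast n.succ_ne_zero
  rw [ascPochhammer_succ_eval, ← e1, Nat.factorial_succ]
  push_cast
  rw [show b + 1 + (n : ℂ) = b + (n + 1) by ring]
  field_simp

theorem regularizedHGFun_zero (a b : ℂ) : regularizedHGFun {a} {b} 0 = (Gamma b)⁻¹ := by
  refine (regularizedHGFun_hasSum a b 0).unique ?_
  convert hasSum_ite_eq (0 : ℕ) ((Gamma b)⁻¹) using 2 with n
  rcases n with _ | n
  · simp
  · simp

/-- The power series of `₂F₁(1, g; b; ·)`. -/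
theorem ordinaryHypergeometric_one_hasSum {g b : ℂ} (hg : ∀ n : ℕ, g ≠ -n) (hb : ∀ n : ℕ, b ≠ -n)
    {c : ℂ} (hc : ‖c‖ < 1) :
    HasSum (fun n : ℕ => (ascPochhammer ℂ n).eval g / (ascPochhammer ℂ n).eval b * c ^ n)
      (ordinaryHypergeometric (1 : ℂ) g b c) := by
  have hr : (ordinaryHypergeometricSeries ℂ (1 : ℂ) g b).radius = 1 := by
    refine ordinaryHypergeometricSeries_radius_eq_one ℂ 1 g b fun n => ⟨fun h => ?_, fun h => ?_,
      fun h => ?_⟩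
    · have : ((n : ℂ) + 1) = 0 := by rw [h]; ring
      exact (Nat.cast_add_one_ne_zero n) this
    · exact hg n (by rw [h]; ring)
    · exact hb n (by rw [h]; ring)
  have h := (ordinaryHypergeometricSeries ℂ (1 : ℂ) g b).hasSum (x := c) (by
    rw [hr, mem_eball_zero_iff, ← ofReal_norm]
    exact ENNReal.ofReal_lt_one.2 hc)
  unfold ordinaryHypergeometric
  refine h.congr_fun fun n => ?_
  have e2 : (n.factorial : ℂ) ≠ 0 := by exact_mod_cast n.factorial_ne_zero
  rw [ordinaryHypergeometricSeries_apply_eq, ascPochhammer_eval_one, inv_mul_cancel₀ e2, smul_eq_mul]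
  ring

theorem ascPochhammer_eval_ne_zero {b : ℂ} (hb : ∀ n : ℕ, b ≠ -n) (n : ℕ) :
    (ascPochhammer ℂ n).eval b ≠ 0 := by
  intro h
  obtain ⟨k, -, hk⟩ := (ascPochhammer_eval_eq_zero_iff n b).1 h
  exact hb k (by rw [hk]; ring)

/-- The upper parameter 1 cancels n!, so dropping the first term shifts g and b together. This is
the counterpart for ₂F₁ of the identity 1/(1 + t) = 1 − t/(1 + t) used in `stieltjesPow_eq`. -/
theorem ordinaryHypergeometric_one_step {g b : ℂ} (hg : ∀ n : ℕ, g ≠ -n) (hb : ∀ n : ℕ, b ≠ -n)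
    {c : ℂ} (hc : ‖c‖ < 1) :
    ordinaryHypergeometric (1 : ℂ) g b c =
      1 + g * c / b * ordinaryHypergeometric (1 : ℂ) (g + 1) (b + 1) c := by
  have hg' : ∀ n : ℕ, g + 1 ≠ -n := fun n h => hg (n + 1) (by push_cast; linear_combination h)
  have hb' : ∀ n : ℕ, b + 1 ≠ -n := fun n h => hb (n + 1) (by push_cast; linear_combination h)
  have hb0 : b ≠ 0 := by simpa using hb 0
  have h1 := (hasSum_nat_add_iff' 1).2 (ordinaryHypergeometric_one_hasSum hg hb hc)
  have h2 := (ordinaryHypergeometric_one_hasSum hg' hb' hc).mul_left (g * c / b)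
  rw [← h1.unique (h2.congr_fun fun n => ?_)]
  · simp
  have e1 := ascPochhammer_eval_add_one g n
  have e2 := ascPochhammer_eval_add_one b n
  rw [ascPochhammer_succ_eval, ascPochhammer_succ_eval, ← e1, ← e2, pow_succ]
  have e3 := ascPochhammer_eval_ne_zero hb' n
  field_simp

/-- The coefficients satisfy (b + n + 1) A(n+1) = (g + n) A(n), that is, (θ + b) F − b = c (θ + g) F
with θ = c d/dc. The hypergeometric equation thus drops to an inhomogeneous one of first order. -/
theorem ordinaryHypergeometric_one_hasDerivAt {g b : ℂ} (hg : ∀ n : ℕ, g ≠ -n)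
    (hb : ∀ n : ℕ, b ≠ -n) {c : ℂ} (hc : ‖c‖ < 1) :
    ∃ d : ℂ, HasDerivAt (ordinaryHypergeometric (1 : ℂ) g (b + 1)) d c ∧
      (1 - c) * (b * ordinaryHypergeometric (1 : ℂ) g (b + 1) c + c * d) +
        (b - g) * c * ordinaryHypergeometric (1 : ℂ) g (b + 1) c = b := by
  have hb' : ∀ n : ℕ, b + 1 ≠ -n := fun n h => hb (n + 1) (by push_cast; linear_combination h)
  have hb0 : b ≠ 0 := by simpa using hb 0
  set A : ℕ → ℂ := fun n => (ascPochhammer ℂ n).eval g / (ascPochhammer ℂ n).eval (b + 1) with hA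
  obtain ⟨d, hd, hs⟩ := hasDerivAt_tsum_mul_pow (a := A) (R := 1)
    (fun x hx => (ordinaryHypergeometric_one_hasSum hg hb' hx).summable.norm) hc
  refine ⟨d, hd.congr_of_eventuallyEq ?_, ?_⟩
  · filter_upwards [(isOpen_lt continuous_norm continuous_const).mem_nhds hc] with x hx
    exact (ordinaryHypergeometric_one_hasSum hg hb' hx).tsum_eq.symm
  have h0 : HasSum (fun n => A n * c ^ n) _ := ordinaryHypergeometric_one_hasSum hg hb' hc
  set F := ordinaryHypergeometric (1 : ℂ) g (b + 1) c
  have hA1 : ∀ n : ℕ, (b + (n + 1)) * A (n + 1) = (g + n) * A n := by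
    intro n
    have e1 := ascPochhammer_eval_ne_zero hb' (n + 1)
    have e2 := ascPochhammer_eval_ne_zero hb' n
    simp only [hA]
    rw [ascPochhammer_succ_eval] at e1 ⊢
    rw [ascPochhammer_succ_eval]
    have e3 : b + 1 + n ≠ 0 := right_ne_zero_of_mul e1
    field_simp
    ring
  have hn : HasSum (fun n : ℕ => n * A n * c ^ n) (c * d) := by
    rw [← hasSum_nat_add_iff' 1]
    simp only [Finset.sum_range_one, Nat.cast_zero, zero_mul, sub_zero]
    refine (hs.mul_left c).congr_fun fun n => ?_
    push_cast
    ring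
  have h1 := (hasSum_nat_add_iff' 1).2 ((h0.mul_left b).add hn)
  have h2 := ((h0.mul_left g).add hn).mul_left c
  have h3 := h1.unique (h2.congr_fun fun n => ?_)
  · simp [hA] at h3
    linear_combination h3
  · have := hA1 n
    push_cast
    linear_combination c ^ (n + 1) * this

/-! ### Powers of t + c on the cut plane and integrals depending on c. -/

theorem add_mem_slitPlane {c : ℂ} (hc : c ∈ slitPlane) {t : ℝ} (ht : 0 ≤ t) :
    (t : ℂ) + c ∈ slitPlane := by
  rw [mem_slitPlane_iff] at hc ⊢
  rcases hc with h | h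
  · left; simp; linarith
  · right; simpa using h

theorem add_ne_zero_of_mem_slitPlane {c : ℂ} (hc : c ∈ slitPlane) {t : ℝ} (ht : 0 ≤ t) :
    (t : ℂ) + c ≠ 0 := slitPlane_ne_zero (add_mem_slitPlane hc ht)

/-- With u = 1/(1 + t), the quotient (t + c)/(1 + t) is the point (1 − u) + u c of the segment from
1 to c. This compact segment avoids 0, and δ is its distance from 0. -/
theorem exists_le_norm_add {c : ℂ} (hc : c ∈ slitPlane) :
    ∃ δ > 0, ∀ t : ℝ, 0 ≤ t → δ * (1 + t) ≤ ‖(t : ℂ) + c‖ := by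
  have hcont : ContinuousOn (fun u : ℝ => ‖((1 - u : ℝ) : ℂ) + u * c‖) (Icc 0 1) := by fun_prop
  obtain ⟨u, hu, hmin⟩ := isCompact_Icc.exists_isMinOn (nonempty_Icc.2 zero_le_one) hcont
  refine ⟨‖((1 - u : ℝ) : ℂ) + u * c‖, norm_pos_iff.2 ?_, fun t ht => ?_⟩
  · rcases hu.1.eq_or_lt with h | h
    · simp [← h]
    · have h1 : (((1 - u) / u : ℝ) : ℂ) + c ≠ 0 :=
        add_ne_zero_of_mem_slitPlane hc (div_nonneg (by linarith [hu.2]) h.le)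
      have h2 : ((1 - u : ℝ) : ℂ) + u * c = u * ((((1 - u) / u : ℝ) : ℂ) + c) := by
        have : (u : ℂ) ≠ 0 := by exact_mod_cast h.ne'
        push_cast
        field_simp
      rw [h2]
      exact mul_ne_zero (by exact_mod_cast h.ne') h1
  · have ht1 : 0 < 1 + t := by linarith
    have h1 := hmin (a := 1 / (1 + t)) ⟨by positivity, by rw [div_le_one ht1]; linarith⟩
    simp only [Set.mem_ofPred_eq] at h1
    have h2 : ((1 - 1 / (1 + t) : ℝ) : ℂ) + (1 / (1 + t) : ℝ) * c =
        ((1 + t : ℝ) : ℂ)⁻¹ * ((t : ℂ) + c) := by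
      have : ((1 + t : ℝ) : ℂ) ≠ 0 := by exact_mod_cast ht1.ne'
      push_cast at this ⊢
      field_simp
      ring
    rw [h2, norm_mul, norm_inv, norm_real, Real.norm_of_nonneg ht1.le] at h1
    calc _ ≤ (1 + t)⁻¹ * ‖(t : ℂ) + c‖ * (1 + t) := mul_le_mul_of_nonneg_right h1 ht1.le
      _ = _ := by field_simp

theorem rpow_le_of_mem_Icc {δ C x y a : ℝ} (hδ : 0 < δ) (hy : 0 < y) (h1 : δ * y ≤ x)
    (h2 : x ≤ C * y) : x ^ a ≤ max (δ ^ a) (C ^ a) * y ^ a := by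
  have hx : 0 < x := (mul_pos hδ hy).trans_le h1
  have hC : 0 < C := pos_of_mul_pos_left (hx.trans_le h2) hy.le
  have hya : 0 ≤ y ^ a := Real.rpow_nonneg hy.le a
  rcases le_total 0 a with ha | ha
  · calc x ^ a ≤ (C * y) ^ a := Real.rpow_le_rpow hx.le h2 ha
      _ = C ^ a * y ^ a := Real.mul_rpow hC.le hy.le
      _ ≤ _ := mul_le_mul_of_nonneg_right (le_max_right _ _) hya
  · calc x ^ a ≤ (δ * y) ^ a := Real.rpow_le_rpow_of_nonpos (by positivity) h1 ha
      _ = δ ^ a * y ^ a := Real.mul_rpow hδ.le hy.le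
      _ ≤ _ := mul_le_mul_of_nonneg_right (le_max_left _ _) hya

theorem norm_cpow_ofReal {x : ℂ} (hx : x ≠ 0) (a : ℝ) : ‖x ^ (a : ℂ)‖ = ‖x‖ ^ a := by
  rw [norm_cpow_of_ne_zero hx]; simp

/-- Locally uniform bound for `(t + c) ^ a`. -/
theorem exists_norm_add_cpow_le {c : ℂ} (hc : c ∈ slitPlane) (a : ℝ) :
    ∃ ε > 0, ∃ K > 0, ∀ c' ∈ Metric.ball c ε, c' ∈ slitPlane ∧
      ∀ t : ℝ, 0 ≤ t → ‖((t : ℂ) + c') ^ (a : ℂ)‖ ≤ K * (1 + t) ^ a := by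
  obtain ⟨δ, hδ, h⟩ := exists_le_norm_add hc
  obtain ⟨η, hη, hball⟩ := Metric.isOpen_iff.1 isOpen_slitPlane c hc
  -- Moving c by less than δ/2 costs at most half of the lower bound δ (1 + t). The maximum covers
  -- both signs of a.
  refine ⟨min η (δ / 2), by positivity, max ((δ / 2) ^ a) ((1 + ‖c‖ + δ) ^ a),
    lt_max_of_lt_left (by positivity), fun c' hc' => ?_⟩
  have h1 : c' ∈ slitPlane := hball (Metric.ball_subset_ball (min_le_left _ _) hc')
  refine ⟨h1, fun t ht => ?_⟩
  have h2 : ‖c' - c‖ < δ / 2 := by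
    rw [← dist_eq_norm]; exact (Metric.mem_ball.1 hc').trans_le (min_le_right _ _)
  rw [norm_cpow_ofReal (add_ne_zero_of_mem_slitPlane h1 ht)]
  refine rpow_le_of_mem_Icc (by positivity) (by linarith) ?_ ?_
  · have h3 : ‖(t : ℂ) + c‖ ≤ ‖(t : ℂ) + c'‖ + ‖c' - c‖ := by
      rw [show (t : ℂ) + c = ((t : ℂ) + c') - (c' - c) by ring]; exact norm_sub_le _ _
    nlinarith [h t ht]
  · have h3 : ‖(t : ℂ) + c'‖ ≤ t + (‖c' - c‖ + ‖c‖) := by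
      calc ‖(t : ℂ) + c'‖ ≤ ‖(t : ℂ)‖ + ‖(c' - c) + c‖ := by
            rw [sub_add_cancel]; exact norm_add_le _ _
        _ ≤ _ := by
            rw [norm_real, Real.norm_of_nonneg ht]
            gcongr
            exact norm_add_le _ _
    nlinarith [norm_nonneg c]

/-- Bound for `(t + r c) ^ a`, uniform in the scaling parameter `r`. -/
theorem exists_norm_add_mul_cpow_le {c : ℂ} (hc : c ∈ slitPlane) (a : ℝ) :
    ∃ K > 0, ∀ t r : ℝ, 0 ≤ t → 0 < r →
      ‖((t : ℂ) + r * c) ^ (a : ℂ)‖ ≤ K * (r + t) ^ a := by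
  obtain ⟨ε, hε, K, hK, h⟩ := exists_norm_add_cpow_le hc a
  refine ⟨K, hK, fun t r ht hr => ?_⟩
  have h1 := (h c (Metric.mem_ball_self hε)).2 (t / r) (by positivity)
  have hr0 : (r : ℂ) ≠ 0 := by exact_mod_cast hr.ne'
  have h2 : (t : ℂ) + r * c = r * (((t / r : ℝ) : ℂ) + c) := by
    push_cast; field_simp
  have h3 := add_ne_zero_of_mem_slitPlane hc (t := t / r) (by positivity)
  rw [norm_cpow_ofReal h3] at h1
  rw [h2, norm_cpow_ofReal (mul_ne_zero hr0 h3), norm_mul, norm_real, Real.norm_of_nonneg hr.le,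
    Real.mul_rpow hr.le (norm_nonneg _), show r + t = r * (1 + t / r) by field_simp,
    Real.mul_rpow hr.le (by positivity)]
  calc _ ≤ r ^ a * (K * (1 + t / r) ^ a) := mul_le_mul_of_nonneg_left h1 (by positivity)
    _ = _ := by ring

theorem integrableOn_one_add_rpow_mul_rpow {a g : ℝ} (hg : 0 < g) (hag : a + g < 0) :
    IntegrableOn (fun t : ℝ => (1 + t) ^ a * t ^ (g - 1)) (Ioi 0) := by
  have hm : ∀ s : Set ℝ, AEStronglyMeasurable (fun t : ℝ => (1 + t) ^ a * t ^ (g - 1))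
      (volume.restrict s) := fun s => by
    apply Measurable.aestronglyMeasurable; fun_prop
  rw [← Ioc_union_Ioi_eq_Ioi zero_le_one]
  refine IntegrableOn.union ?_ ?_
  · have h1 : IntegrableOn (fun t : ℝ => max ((1 : ℝ) ^ a) ((2 : ℝ) ^ a) * t ^ (g - 1)) (Ioc 0 1) :=
      Integrable.const_mul ((intervalIntegrable_iff_integrableOn_Ioc_of_le zero_le_one).1
        (intervalIntegral.intervalIntegrable_rpow' (by linarith))) _
    refine Integrable.mono' h1 (hm _) ?_
    filter_upwards [ae_restrict_mem measurableSet_Ioc] with t ht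
    rw [Real.norm_of_nonneg (mul_nonneg (Real.rpow_nonneg (by linarith [ht.1]) _)
      (Real.rpow_nonneg ht.1.le _))]
    have := rpow_le_of_mem_Icc (δ := 1) (C := 2) (x := 1 + t) (y := 1) (a := a) one_pos one_pos
      (by linarith [ht.1]) (by linarith [ht.2])
    rw [Real.one_rpow, mul_one] at this
    refine mul_le_mul_of_nonneg_right ?_ (Real.rpow_nonneg ht.1.le _)
    simpa using this
  · have h1 : IntegrableOn (fun t : ℝ => max ((1 : ℝ) ^ a) ((2 : ℝ) ^ a) * t ^ (a + g - 1)) (Ioi 1) :=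
      Integrable.const_mul (integrableOn_Ioi_rpow_of_lt (by linarith) one_pos) _
    refine Integrable.mono' h1 (hm _) ?_
    filter_upwards [ae_restrict_mem measurableSet_Ioi] with t ht
    have ht0 : 0 < t := one_pos.trans ht
    rw [Real.norm_of_nonneg (by positivity), show a + g - 1 = a + (g - 1) by ring,
      Real.rpow_add ht0, ← mul_assoc]
    refine mul_le_mul_of_nonneg_right ?_ (Real.rpow_nonneg ht0.le _)
    exact rpow_le_of_mem_Icc one_pos ht0 (by linarith) (by linarith [mem_Ioi.1 ht])

theorem continuousOn_add_cpow {c : ℂ} (hc : c ∈ slitPlane) (a : ℂ) :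
    ContinuousOn (fun t : ℝ => ((t : ℂ) + c) ^ a) (Ici 0) := fun t ht =>
  (ContinuousAt.cpow (f := fun t : ℝ => (t : ℂ) + c) (by fun_prop) continuousAt_const
    (add_mem_slitPlane hc ht)).continuousWithinAt

theorem aestronglyMeasurable_add_cpow {c : ℂ} (hc : c ∈ slitPlane) (a : ℂ) :
    AEStronglyMeasurable (fun t : ℝ => ((t : ℂ) + c) ^ a) (volume.restrict (Ioi 0)) :=
  ((continuousOn_add_cpow hc a).mono Ioi_subset_Ici_self).aestronglyMeasurable measurableSet_Ioi

theorem integrableOn_add_cpow_mul {c : ℂ} (hc : c ∈ slitPlane) {a : ℝ} {w : ℝ → ℂ}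
    (hw : AEStronglyMeasurable w (volume.restrict (Ioi 0)))
    (hint : IntegrableOn (fun t : ℝ => (1 + t) ^ a * ‖w t‖) (Ioi 0)) :
    IntegrableOn (fun t : ℝ => ((t : ℂ) + c) ^ (a : ℂ) * w t) (Ioi 0) := by
  obtain ⟨ε, hε, K, hK, h⟩ := exists_norm_add_cpow_le hc a
  refine Integrable.mono' (hint.const_mul K) ((aestronglyMeasurable_add_cpow hc _).mul hw) ?_
  filter_upwards [ae_restrict_mem measurableSet_Ioi] with t ht
  rw [norm_mul, ← mul_assoc]
  exact mul_le_mul_of_nonneg_right ((h c (Metric.mem_ball_self hε)).2 t (mem_Ioi.1 ht).le)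
    (norm_nonneg _)

/-- The weight w is left general so that the statement serves both the Beta integral, with w =
t^(g−1), and the Stieltjes integral, with w = t^(g−1)/(1 + t). -/
theorem hasDerivAt_integral_add_cpow {c : ℂ} (hc : c ∈ slitPlane) {a : ℝ} {w : ℝ → ℂ}
    (hw : AEStronglyMeasurable w (volume.restrict (Ioi 0)))
    (hint : IntegrableOn (fun t : ℝ => (1 + t) ^ a * ‖w t‖) (Ioi 0)) :
    HasDerivAt (fun c : ℂ => ∫ t in Ioi (0 : ℝ), ((t : ℂ) + c) ^ (a : ℂ) * w t)
      (a * ∫ t in Ioi (0 : ℝ), ((t : ℂ) + c) ^ ((a - 1 : ℝ) : ℂ) * w t) c := by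
  obtain ⟨ε, hε, K, hK, h⟩ := exists_norm_add_cpow_le hc (a - 1)
  have := (hasDerivAt_integral_of_dominated_loc_of_deriv_le (μ := volume.restrict (Ioi 0))
    (F := fun c (t : ℝ) => ((t : ℂ) + c) ^ (a : ℂ) * w t)
    (F' := fun c (t : ℝ) => a * (((t : ℂ) + c) ^ ((a - 1 : ℝ) : ℂ) * w t)) (x₀ := c)
    (bound := fun t => |a| * K * ((1 + t) ^ a * ‖w t‖))
    (Metric.ball_mem_nhds c hε) ?_ (integrableOn_add_cpow_mul hc hw hint)
    (((aestronglyMeasurable_add_cpow hc _).mul hw).const_mul _) ?_ (hint.const_mul _) ?_).2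
  · rwa [integral_const_mul] at this
  · filter_upwards [isOpen_slitPlane.mem_nhds hc] with c' hc'
    exact (aestronglyMeasurable_add_cpow hc' _).mul hw
  · filter_upwards [ae_restrict_mem measurableSet_Ioi] with t ht c' hc'
    have ht0 : 0 < t := ht
    have h1 := (h c' hc').2 t ht0.le
    have h2 : (1 + t) ^ (a - 1) ≤ (1 + t) ^ a :=
      Real.rpow_le_rpow_of_exponent_le (by linarith) (by linarith)
    rw [norm_mul, norm_mul, norm_real, Real.norm_eq_abs]
    calc |a| * (‖((t : ℂ) + c') ^ ((a - 1 : ℝ) : ℂ)‖ * ‖w t‖)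
        ≤ |a| * ((K * (1 + t) ^ a) * ‖w t‖) := by
          gcongr
          exact h1.trans (by gcongr)
      _ = _ := by ring
  · filter_upwards [ae_restrict_mem measurableSet_Ioi] with t ht c' hc'
    have h1 := (((hasDerivAt_id' c').const_add (t : ℂ)).cpow_const (c := (a : ℂ))
      (add_mem_slitPlane (h c' hc').1 (mem_Ioi.1 ht).le)).mul_const (w t)
    refine h1.congr_deriv ?_
    push_cast
    ring

/-! ### The power kernel and Euler's Beta integral on the cut plane. -/

/-- The kernel `(t + c) ^ a * t ^ (g - 1)`. -/
noncomputable def powKernel (a g : ℝ) (c : ℂ) (t : ℝ) : ℂ :=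
  ((t : ℂ) + c) ^ (a : ℂ) * (t : ℂ) ^ ((g : ℂ) - 1)

theorem powKernel_zero (a : ℝ) {g : ℝ} (hg : 0 < g) (c : ℂ) : powKernel a (g + 1) c 0 = 0 := by
  have : (g : ℂ) ≠ 0 := by exact_mod_cast hg.ne'
  simp [powKernel, this]

theorem powKernel_add_one_right (a g : ℝ) (c : ℂ) {t : ℝ} (ht : 0 < t) :
    powKernel a (g + 1) c t = t * powKernel a g c t := by
  have h : (t : ℂ) ≠ 0 := by exact_mod_cast ht.ne'
  rw [powKernel, powKernel, show (((g + 1 : ℝ) : ℂ) - 1) = ((g : ℂ) - 1) + 1 by push_cast; ring,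
    cpow_add _ _ h, cpow_one]
  ring

theorem powKernel_add_one_left (a g : ℝ) {c : ℂ} (hc : c ∈ slitPlane) {t : ℝ} (ht : 0 ≤ t) :
    powKernel (a + 1) g c t = (t + c) * powKernel a g c t := by
  rw [powKernel, powKernel, ofReal_add, ofReal_one,
    cpow_add _ _ (add_ne_zero_of_mem_slitPlane hc ht), cpow_one]
  ring

theorem continuousOn_powKernel (a g : ℝ) {c : ℂ} (hc : c ∈ slitPlane) :
    ContinuousOn (powKernel a g c) (Ioi 0) := by
  refine ((continuousOn_add_cpow hc _).mono Ioi_subset_Ici_self).mul fun t ht => ?_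
  exact (continuousAt_ofReal_cpow_const t _ (Or.inr (mem_Ioi.1 ht).ne')).continuousWithinAt

theorem continuousWithinAt_powKernel_zero (a : ℝ) {g : ℝ} (hg : 0 < g) {c : ℂ}
    (hc : c ∈ slitPlane) : ContinuousWithinAt (powKernel a (g + 1) c) (Ici 0) 0 := by
  refine (continuousOn_add_cpow hc _ 0 self_mem_Ici).mul ?_
  exact (continuousAt_ofReal_cpow_const 0 _ (Or.inl (by simpa using hg))).continuousWithinAt

theorem aestronglyMeasurable_powKernel (a g : ℝ) {c : ℂ} (hc : c ∈ slitPlane) :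
    AEStronglyMeasurable (powKernel a g c) (volume.restrict (Ioi 0)) :=
  (continuousOn_powKernel a g hc).aestronglyMeasurable measurableSet_Ioi

theorem norm_ofReal_cpow_sub_one (g : ℝ) {t : ℝ} (ht : 0 < t) :
    ‖(t : ℂ) ^ ((g : ℂ) - 1)‖ = t ^ (g - 1) := by
  rw [norm_cpow_eq_rpow_re_of_pos ht]; simp

theorem exists_norm_powKernel_le (a g : ℝ) {c : ℂ} (hc : c ∈ slitPlane) :
    ∃ K > 0, ∀ t : ℝ, 0 < t → ‖powKernel a g c t‖ ≤ K * ((1 + t) ^ a * t ^ (g - 1)) := by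
  obtain ⟨ε, hε, K, hK, h⟩ := exists_norm_add_cpow_le hc a
  refine ⟨K, hK, fun t ht => ?_⟩
  rw [powKernel, norm_mul, norm_ofReal_cpow_sub_one g ht, ← mul_assoc]
  exact mul_le_mul_of_nonneg_right ((h c (Metric.mem_ball_self hε)).2 t ht.le) (by positivity)

theorem integrableOn_powKernel {a g : ℝ} (hg : 0 < g) (hag : a + g < 0) {c : ℂ}
    (hc : c ∈ slitPlane) : IntegrableOn (powKernel a g c) (Ioi 0) := by
  obtain ⟨K, hK, h⟩ := exists_norm_powKernel_le a g hc
  refine Integrable.mono' ((integrableOn_one_add_rpow_mul_rpow hg hag).const_mul K)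
    (aestronglyMeasurable_powKernel a g hc) ?_
  filter_upwards [ae_restrict_mem measurableSet_Ioi] with t ht
  exact h t ht

theorem hasDerivAt_powKernel (a g : ℝ) {c : ℂ} (hc : c ∈ slitPlane) {t : ℝ} (ht : 0 < t) :
    HasDerivAt (powKernel a (g + 1) c)
      (a * powKernel (a - 1) (g + 1) c t + g * powKernel a g c t) t := by
  have h1 : HasDerivAt (fun x : ℂ => (x + c) ^ (a : ℂ)) (a * (t + c) ^ ((a : ℂ) - 1) * 1) (t : ℂ) :=
    ((hasDerivAt_id' (t : ℂ)).add_const c).cpow_const (add_mem_slitPlane hc ht.le)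
  have h2 : HasDerivAt (fun x : ℂ => x ^ (((g + 1 : ℝ) : ℂ) - 1))
      ((((g + 1 : ℝ) : ℂ) - 1) * (t : ℂ) ^ ((((g + 1 : ℝ) : ℂ) - 1) - 1) * 1) (t : ℂ) :=
    (hasDerivAt_id' (t : ℂ)).cpow_const (ofReal_mem_slitPlane.2 ht)
  refine (h1.mul h2).comp_ofReal.congr_deriv ?_
  simp only [powKernel]
  push_cast
  rw [show (g : ℂ) + 1 - 1 - 1 = g - 1 by ring, show (g : ℂ) + 1 - 1 = g by ring]
  ring

theorem tendsto_powKernel_atTop {a g : ℝ} (hag : a + g < 0) {c : ℂ} (hc : c ∈ slitPlane) :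
    Tendsto (powKernel a (g + 1) c) atTop (𝓝 0) := by
  obtain ⟨K, hK, h⟩ := exists_norm_powKernel_le a (g + 1) hc
  have h1 : Tendsto (fun t : ℝ => K * (max ((1 : ℝ) ^ a) ((2 : ℝ) ^ a) * t ^ (a + g)))
      atTop (𝓝 0) := by
    have := ((tendsto_rpow_neg_atTop (y := -(a + g)) (by linarith)).const_mul
      (max ((1 : ℝ) ^ a) ((2 : ℝ) ^ a))).const_mul K
    simpa using this
  refine squeeze_zero_norm' ?_ h1
  filter_upwards [eventually_ge_atTop 1] with t ht
  have ht0 : 0 < t := one_pos.trans_le ht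
  refine (h t ht0).trans ?_
  rw [Real.rpow_add ht0, ← mul_assoc (max _ _), add_sub_cancel_right]
  gcongr
  exact rpow_le_of_mem_Icc one_pos ht0 (by linarith) (by linarith)

/-- Integration by parts for `∫ (t + c) ^ a * t ^ (g - 1)`. -/
theorem integral_powKernel_parts {a g : ℝ} (hg : 0 < g) (hag : a + g < 0) {c : ℂ}
    (hc : c ∈ slitPlane) :
    (a + g) * ∫ t in Ioi (0 : ℝ), powKernel a g c t =
      a * c * ∫ t in Ioi (0 : ℝ), powKernel (a - 1) g c t := by
  have i1 := integrableOn_powKernel hg hag hc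
  have i2 := integrableOn_powKernel (a := a - 1) hg (by linarith) hc
  -- This is the derivative of (t + c)^a t^g, which vanishes at 0 and at ∞, rewritten with t = (t +
  -- c) − c.
  have he : ∀ t ∈ Ioi (0 : ℝ), a * powKernel (a - 1) (g + 1) c t + g * powKernel a g c t =
      (a + g) * powKernel a g c t - a * c * powKernel (a - 1) g c t := by
    intro t ht
    have e1 := powKernel_add_one_left (a - 1) g hc (mem_Ioi.1 ht).le
    rw [sub_add_cancel] at e1
    rw [powKernel_add_one_right _ _ _ ht, e1]
    ring
  have h := integral_Ioi_of_hasDerivAt_of_tendsto (continuousWithinAt_powKernel_zero a hg hc)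
    (fun t ht => (hasDerivAt_powKernel a g hc ht).congr_deriv (he t ht))
    ((i1.const_mul _).sub (i2.const_mul _)) (tendsto_powKernel_atTop hag hc)
  rw [integral_sub (i1.const_mul _) (i2.const_mul _), integral_const_mul, integral_const_mul,
    powKernel_zero a hg] at h
  linear_combination h

theorem image_div_one_add : (fun t : ℝ => t / (1 + t)) '' Ioi 0 = Ioo 0 1 := by
  ext x
  constructor
  · rintro ⟨t, ht, rfl⟩
    have ht0 : 0 < t := ht
    exact ⟨by positivity, by rw [div_lt_one (by positivity)]; linarith⟩
  · rintro ⟨h0, h1⟩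
    have : 0 < 1 - x := by linarith
    refine ⟨x / (1 - x), by simp only [mem_Ioi]; positivity, ?_⟩
    simp only
    field_simp
    ring

/-- The substitution x = t/(1 + t) turns this into the Beta integral over (0, 1). -/
theorem integral_powKernel_one {a g : ℝ} (hg : 0 < g) (hag : a + g < 0) :
    ∫ t in Ioi (0 : ℝ), powKernel a g 1 t = Gamma g * Gamma (-(a + g)) / Gamma (-a) := by
  have h1 : betaIntegral g (-(a + g) : ℝ) = Gamma g * Gamma (-(a + g)) / Gamma (-a) := by
    rw [betaIntegral_eq_Gamma_mul_div _ _ (by simpa using hg) (by rw [ofReal_re]; linarith)]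
    push_cast
    rw [show (g : ℂ) + -(a + g) = -a by ring]
  rw [← h1, betaIntegral, intervalIntegral.integral_of_le zero_le_one,
    integral_Ioc_eq_integral_Ioo, ← image_div_one_add,
    integral_image_eq_integral_abs_deriv_smul (f' := fun t => 1 / (1 + t) ^ 2) measurableSet_Ioi]
  · refine setIntegral_congr_fun measurableSet_Ioi fun t ht => ?_
    have ht0 : 0 < t := ht
    have ht1 : 0 < 1 + t := by linarith
    have e1 : ((t / (1 + t) : ℝ) : ℂ) ^ ((g : ℂ) - 1) =
        (t : ℂ) ^ ((g : ℂ) - 1) * ((1 + t : ℝ) : ℂ) ^ (1 - (g : ℂ)) := by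
      rw [div_eq_mul_inv, ofReal_mul, mul_cpow_ofReal_nonneg ht0.le (by positivity), ofReal_inv,
        inv_cpow _ _ (by rw [arg_ofReal_of_nonneg ht1.le]; exact Real.pi_pos.ne), ← cpow_neg,
        neg_sub]
    have e2 : (1 - ((t / (1 + t) : ℝ) : ℂ)) ^ (((-(a + g) : ℝ) : ℂ) - 1) =
        ((1 + t : ℝ) : ℂ) ^ ((a : ℂ) + g + 1) := by
      rw [show (1 - ((t / (1 + t) : ℝ) : ℂ)) = (((1 + t)⁻¹ : ℝ) : ℂ) by
        rw [← ofReal_one, ← ofReal_sub]; congr 1; field_simp; ring, ofReal_inv,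
        inv_cpow _ _ (by rw [arg_ofReal_of_nonneg ht1.le]; exact Real.pi_pos.ne), ← cpow_neg]
      push_cast
      ring_nf
    have e3 : ((1 + t : ℝ) : ℂ) ^ (a : ℂ) = ((1 + t : ℝ) : ℂ) ^ (1 - (g : ℂ)) *
        ((1 + t : ℝ) : ℂ) ^ ((a : ℂ) + g + 1) * ((1 / (1 + t) ^ 2 : ℝ) : ℂ) := by
      have h0 : ((1 + t : ℝ) : ℂ) ≠ 0 := by exact_mod_cast ht1.ne'
      rw [← cpow_add _ _ h0, show 1 - (g : ℂ) + (a + g + 1) = a + (2 : ℕ) by push_cast; ring,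
        cpow_add _ _ h0, cpow_natCast]
      push_cast at h0 ⊢
      field_simp
    simp only [powKernel]
    rw [e1, e2, abs_of_pos (by positivity), real_smul, add_comm (t : ℂ) 1,
      show (1 : ℂ) + t = ((1 + t : ℝ) : ℂ) by push_cast; rfl, e3]
    ring
  · intro t ht
    have ht1 : 1 + t ≠ 0 := by linarith [mem_Ioi.1 ht]
    have := ((hasDerivAt_id' t).div ((hasDerivAt_id' t).const_add 1) ht1).hasDerivWithinAt (s := Ioi 0)
    refine this.congr_deriv ?_
    field_simp
    ring
  · intro t ht s hs hts
    have ht1 : 1 + t ≠ 0 := by linarith [mem_Ioi.1 ht]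
    have hs1 : 1 + s ≠ 0 := by linarith [mem_Ioi.1 hs]
    simp only at hts
    field_simp at hts
    linarith

/-- Euler's Beta integral `∫ (t + c) ^ a * t ^ (g - 1)` on the cut plane. -/
theorem integral_powKernel {a g : ℝ} (hg : 0 < g) (hag : a + g < 0) {c : ℂ} (hc : c ∈ slitPlane) :
    ∫ t in Ioi (0 : ℝ), powKernel a g c t =
      Gamma g * Gamma (-(a + g)) / Gamma (-a) * c ^ ((a : ℂ) + g) := by
  -- Integration by parts says that the integral is homogeneous of degree a + g in c. Dividing by
  -- c^(a+g) leaves a constant on the connected cut plane, whose value is read off at c = 1.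
  have hd : ∀ x ∈ slitPlane, HasDerivAt
      (fun x => (∫ t in Ioi (0 : ℝ), powKernel a g x t) * x ^ (-((a : ℂ) + g))) 0 x := by
    intro x hx
    have hx0 := slitPlane_ne_zero hx
    have hw : AEStronglyMeasurable (fun t : ℝ => (t : ℂ) ^ ((g : ℂ) - 1))
        (volume.restrict (Ioi 0)) := by
      apply ContinuousOn.aestronglyMeasurable _ measurableSet_Ioi
      exact fun t ht =>
        (continuousAt_ofReal_cpow_const t _ (Or.inr (mem_Ioi.1 ht).ne')).continuousWithinAt
    have h1 := hasDerivAt_integral_add_cpow hx (a := a) hw ((integrableOn_one_add_rpow_mul_rpow hg hag).congr_fun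
      (fun t ht => by simp only; rw [norm_ofReal_cpow_sub_one g ht]) measurableSet_Ioi)
    have h2 : HasDerivAt (fun x : ℂ => x ^ (-((a : ℂ) + g))) _ x :=
      (hasDerivAt_id' x).cpow_const hx
    refine (h1.mul h2).congr_deriv ?_
    have h3 := integral_powKernel_parts hg hag hx
    simp only [powKernel] at h3
    rw [cpow_sub _ _ hx0, cpow_one]
    field_simp
    linear_combination -x ^ (-((a : ℂ) + g)) * h3
  have h := isOpen_slitPlane.is_const_of_deriv_eq_zero
    (starConvex_one_slitPlane.isPathConnected one_mem_slitPlane).isConnected.isPreconnected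
    (fun x hx => (hd x hx).differentiableAt.differentiableWithinAt)
    (fun x hx => (hd x hx).deriv) hc one_mem_slitPlane
  simp only [one_cpow, mul_one, integral_powKernel_one hg hag] at h
  rw [← h, mul_assoc, ← cpow_add _ _ (slitPlane_ne_zero hc)]
  simp

/-! ### Laplace transforms and Kummer's equation. -/

theorem rpow_mul_exp_neg_le (p : ℝ) {ε : ℝ} (hε : 0 < ε) :
    ∃ C > 0, ∀ t : ℝ, 0 ≤ t → (1 + t) ^ p ≤ C * Real.exp (ε * t) := by
  obtain ⟨n, hn⟩ := exists_nat_ge p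
  refine ⟨(n.factorial / ε ^ n) * Real.exp ε, by positivity, fun t ht => ?_⟩
  have h1 : (1 + t) ^ p ≤ (1 + t) ^ n := by
    rw [← Real.rpow_natCast]
    exact Real.rpow_le_rpow_of_exponent_le (by linarith) hn
  have h2 := Real.pow_div_factorial_le_exp (ε * (1 + t)) (by positivity) n
  rw [div_le_iff₀ (by positivity), mul_pow] at h2
  refine h1.trans ?_
  rw [mul_assoc, ← Real.exp_add, div_mul_eq_mul_div, le_div_iff₀ (by positivity),
    show ε + ε * t = ε * (1 + t) by ring]
  linarith

/-- Functions on `(0, ∞)` of subexponential growth, so that the Laplace transform converges on the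
right half plane. -/
def LaplaceIntegrable (f : ℝ → ℂ) : Prop :=
  AEStronglyMeasurable f (volume.restrict (Ioi 0)) ∧
    ∀ ε > 0, IntegrableOn (fun t : ℝ => Real.exp (-(ε * t)) * ‖f t‖) (Ioi 0)

theorem norm_exp_neg_mul (s : ℂ) (t : ℝ) : ‖cexp (-s * t)‖ = Real.exp (-(s.re * t)) := by
  rw [norm_exp]; simp

theorem aestronglyMeasurable_exp_neg_mul (s : ℂ) (μ : Measure ℝ) :
    AEStronglyMeasurable (fun t : ℝ => cexp (-s * t)) μ := by
  apply Continuous.aestronglyMeasurable; fun_prop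

theorem LaplaceIntegrable.integrableOn {f : ℝ → ℂ} (hf : LaplaceIntegrable f) {s : ℂ}
    (hs : 0 < s.re) : IntegrableOn (fun t : ℝ => f t * cexp (-s * t)) (Ioi 0) := by
  refine Integrable.mono' (hf.2 _ hs) (hf.1.mul (aestronglyMeasurable_exp_neg_mul s _)) ?_
  filter_upwards with t
  rw [norm_mul, norm_exp_neg_mul, mul_comm]

theorem LaplaceIntegrable.of_norm_le {f : ℝ → ℂ} {w : ℝ → ℝ} {p : ℝ}
    (hf : AEStronglyMeasurable f (volume.restrict (Ioi 0))) (hw : IntegrableOn w (Ioi 0))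
    (h : ∀ t : ℝ, 0 < t → ‖f t‖ ≤ (1 + t) ^ p * w t) : LaplaceIntegrable f := by
  refine ⟨hf, fun ε hε => ?_⟩
  obtain ⟨C, hC, hCt⟩ := rpow_mul_exp_neg_le p hε
  refine Integrable.mono' (hw.const_mul C) ?_ ?_
  · exact (Continuous.aestronglyMeasurable (by fun_prop)).mul hf.norm
  · filter_upwards [ae_restrict_mem measurableSet_Ioi] with t ht
    have ht0 : 0 < t := ht
    rw [Real.norm_of_nonneg (by positivity)]
    have h0 : 0 ≤ w t := by
      have := (norm_nonneg _).trans (h t ht0)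
      exact nonneg_of_mul_nonneg_right this (by positivity)
    calc Real.exp (-(ε * t)) * ‖f t‖
        ≤ Real.exp (-(ε * t)) * ((C * Real.exp (ε * t)) * w t) := by
          gcongr
          exact (h t ht0).trans (mul_le_mul_of_nonneg_right (hCt t ht0.le) h0)
      _ = (Real.exp (-(ε * t)) * Real.exp (ε * t)) * (C * w t) := by ring
      _ = C * w t := by rw [← Real.exp_add]; simp

theorem LaplaceIntegrable.hasDerivAt {f : ℝ → ℂ} (hf : LaplaceIntegrable f) {s : ℂ}
    (hs : 0 < s.re) :
    HasDerivAt (fun s => ∫ t in Ioi (0 : ℝ), f t * cexp (-s * t))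
      (-∫ t in Ioi (0 : ℝ), (t * f t) * cexp (-s * t)) s := by
  set σ := s.re
  have hre : ∀ s' ∈ Metric.ball s (σ / 2), σ / 2 ≤ s'.re := fun s' hs' => by
    have h1 := (abs_re_le_norm (s' - s)).trans_lt (mem_ball_iff_norm.1 hs')
    rw [sub_re, abs_lt] at h1
    linarith [h1.1]
  obtain ⟨C, hC, hCt⟩ := rpow_mul_exp_neg_le 1 (ε := σ / 4) (by positivity)
  have := (hasDerivAt_integral_of_dominated_loc_of_deriv_le (μ := volume.restrict (Ioi 0))
    (F := fun s (t : ℝ) => f t * cexp (-s * t))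
    (F' := fun s (t : ℝ) => -((t * f t) * cexp (-s * t))) (x₀ := s)
    (bound := fun t => C * (Real.exp (-(σ / 4 * t)) * ‖f t‖))
    (Metric.ball_mem_nhds s (half_pos hs)) ?_ (hf.integrableOn hs)
    ?_ ?_ ((hf.2 _ (by positivity)).const_mul C) ?_).2
  · rwa [integral_neg] at this
  · exact Eventually.of_forall fun s' => hf.1.mul (aestronglyMeasurable_exp_neg_mul s' _)
  · exact ((((continuous_ofReal.aestronglyMeasurable)).mul hf.1).mul
      (aestronglyMeasurable_exp_neg_mul s _)).neg
  · filter_upwards [ae_restrict_mem measurableSet_Ioi] with t ht s' hs'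
    have ht0 : 0 < t := ht
    have h1 := hCt t ht0.le
    rw [Real.rpow_one] at h1
    have h2 : Real.exp (-(s'.re * t)) ≤ Real.exp (-(σ / 2 * t)) := by
      apply Real.exp_le_exp.2
      have := mul_le_mul_of_nonneg_right (hre s' hs') ht0.le
      linarith
    rw [norm_neg, norm_mul, norm_mul, norm_real, Real.norm_of_nonneg ht0.le, norm_exp_neg_mul]
    calc t * ‖f t‖ * Real.exp (-(s'.re * t))
        ≤ (C * Real.exp (σ / 4 * t)) * ‖f t‖ * Real.exp (-(σ / 2 * t)) := by
          gcongr
          linarith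
      _ = C * ((Real.exp (σ / 4 * t) * Real.exp (-(σ / 2 * t))) * ‖f t‖) := by ring
      _ = _ := by
          rw [← Real.exp_add]
          ring_nf
  · filter_upwards with t s' _
    have h1 : HasDerivAt (fun s : ℂ => -s * t) (-1 * t) s' := (hasDerivAt_id' s').neg.mul_const _
    refine (h1.cexp.const_mul (f t)).congr_deriv ?_
    ring

theorem laplaceIntegrable_powKernel (a : ℝ) {g : ℝ} (hg : 0 < g) {c : ℂ} (hc : c ∈ slitPlane) :
    LaplaceIntegrable (powKernel a g c) := by
  obtain ⟨K, hK, h⟩ := exists_norm_powKernel_le a g hc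
  refine LaplaceIntegrable.of_norm_le (p := a + g + 1) (aestronglyMeasurable_powKernel a g hc)
    ((integrableOn_one_add_rpow_mul_rpow (a := -g - 1) hg (by linarith)).const_mul K)
    fun t ht => (h t ht).trans_eq ?_
  have : (1 + t) ^ a = (1 + t) ^ (a + g + 1) * (1 + t) ^ (-g - 1) := by
    rw [← Real.rpow_add (by linarith)]; ring_nf
  rw [this]
  ring

/-- The Laplace transform of `powKernel`. -/
noncomputable def laplacePow (a g : ℝ) (c s : ℂ) : ℂ :=
  ∫ t in Ioi (0 : ℝ), powKernel a g c t * cexp (-s * t)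

/-- The factor t brought down by differentiation is absorbed by raising g. Up to sign all
derivatives stay in the family, so a differential equation becomes a relation between g, g + 1 and g
+ 2. -/
theorem laplacePow_hasDerivAt (a : ℝ) {g : ℝ} (hg : 0 < g) {c : ℂ} (hc : c ∈ slitPlane) {s : ℂ}
    (hs : 0 < s.re) : HasDerivAt (laplacePow a g c) (-laplacePow a (g + 1) c s) s := by
  refine ((laplaceIntegrable_powKernel a hg hc).hasDerivAt hs).congr_deriv ?_
  congr 1
  refine setIntegral_congr_fun measurableSet_Ioi fun t ht => ?_
  rw [powKernel_add_one_right a g c ht]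

theorem tendsto_powKernel_mul_exp_atTop (a : ℝ) {g : ℝ} (hg : 0 < g) {c : ℂ} (hc : c ∈ slitPlane)
    {s : ℂ} (hs : 0 < s.re) :
    Tendsto (fun t : ℝ => powKernel a (g + 1) c t * cexp (-s * t)) atTop (𝓝 0) := by
  obtain ⟨K, hK, h⟩ := exists_norm_powKernel_le a (g + 1) hc
  obtain ⟨C, hC, hCt⟩ := rpow_mul_exp_neg_le (a + g) (half_pos hs)
  have h1 : Tendsto (fun t : ℝ => K * C * Real.exp (-(s.re / 2 * t))) atTop (𝓝 0) := by
    have h2 : Tendsto (fun t : ℝ => s.re / 2 * t) atTop atTop :=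
      tendsto_id.const_mul_atTop (half_pos hs)
    simpa using (Real.tendsto_exp_neg_atTop_nhds_zero.comp h2).const_mul (K * C)
  refine squeeze_zero_norm' ?_ h1
  filter_upwards [eventually_gt_atTop 0] with t ht
  rw [norm_mul, norm_exp_neg_mul]
  have h3 : (1 + t) ^ a * t ^ (g + 1 - 1) ≤ (1 + t) ^ (a + g) := by
    rw [add_sub_cancel_right, Real.rpow_add (by linarith)]
    gcongr
    linarith
  calc _ ≤ (K * (C * Real.exp (s.re / 2 * t))) * Real.exp (-(s.re * t)) := by
        refine mul_le_mul_of_nonneg_right ((h t ht).trans ?_) (Real.exp_pos _).le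
        exact mul_le_mul_of_nonneg_left (h3.trans (hCt t ht.le)) hK.le
    _ = K * C * (Real.exp (s.re / 2 * t) * Real.exp (-(s.re * t))) := by ring
    _ = _ := by rw [← Real.exp_add]; ring_nf

/-- Kummer's differential equation for the Laplace transform, as a three term relation. -/
theorem laplacePow_kummer (a : ℝ) {g : ℝ} (hg : 0 < g) {c : ℂ} (hc : c ∈ slitPlane) {s : ℂ}
    (hs : 0 < s.re) :
    s * laplacePow a (g + 1 + 1) c s - (1 + (a + g) - c * s) * laplacePow a (g + 1) c s
      - g * c * laplacePow a g c s = 0 := by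
  have i0 := (laplaceIntegrable_powKernel a hg hc).integrableOn hs
  have i1 := (laplaceIntegrable_powKernel a (g := g + 1) (by linarith) hc).integrableOn hs
  have i2 := (laplaceIntegrable_powKernel a (g := g + 1 + 1) (by linarith) hc).integrableOn hs
  -- The relation is the vanishing of the integral of the derivative of (t + c)^(a+1) t^g e^(−st),
  -- which is 0 at both ends.
  have hd : ∀ t ∈ Ioi (0 : ℝ), HasDerivAt (fun t : ℝ => powKernel (a + 1) (g + 1) c t * cexp (-s * t))
      (((1 + (a + g) - c * s) * (powKernel a (g + 1) c t * cexp (-s * t)) +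
        g * c * (powKernel a g c t * cexp (-s * t))) -
        s * (powKernel a (g + 1 + 1) c t * cexp (-s * t))) t := by
    intro t ht
    have h1 : HasDerivAt (fun x : ℂ => -s * x) (-s) (t : ℂ) := by
      simpa using (hasDerivAt_id' (t : ℂ)).const_mul (-s)
    refine ((hasDerivAt_powKernel (a + 1) g hc ht).mul h1.cexp.comp_ofReal).congr_deriv ?_
    have ht0 : 0 ≤ t := (mem_Ioi.1 ht).le
    rw [add_sub_cancel_right, powKernel_add_one_left a g hc ht0,
      powKernel_add_one_left a (g + 1) hc ht0, powKernel_add_one_right a (g + 1) c ht,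
      powKernel_add_one_right a g c ht]
    push_cast
    ring
  have i3 : IntegrableOn (fun t : ℝ => (1 + (a + g) - c * s) *
      (powKernel a (g + 1) c t * cexp (-s * t)) + g * c * (powKernel a g c t * cexp (-s * t)))
      (Ioi 0) := (i1.const_mul _).add (i0.const_mul _)
  have hcont : ContinuousWithinAt
      (fun t : ℝ => powKernel (a + 1) (g + 1) c t * cexp (-s * t)) (Ici 0) 0 :=
    (continuousWithinAt_powKernel_zero (a + 1) hg hc).mul (by fun_prop)
  have h := integral_Ioi_of_hasDerivAt_of_tendsto hcont hd
    (i3.sub (i2.const_mul _))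
    (tendsto_powKernel_mul_exp_atTop (a + 1) hg hc hs)
  rw [integral_sub i3 (i2.const_mul _),
    integral_add (i1.const_mul _) (i0.const_mul _), integral_const_mul, integral_const_mul,
    integral_const_mul, powKernel_zero _ hg] at h
  simp only [laplacePow]
  linear_combination -h

/-! ### Behaviour of the Laplace transform at s → 0+ for 0 < a + g < 1. -/

/-- Mean value inequality along u ↦ t + u c for u in [0, 1]. As a < 1, the bound (u + t)^(a−1) on
the derivative is at most t^(a−1). -/
theorem norm_add_cpow_sub_cpow_le {a : ℝ} (ha : a < 1) {c : ℂ} (hc : c ∈ slitPlane) :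
    ∃ K, ∀ t : ℝ, 0 < t → ‖((t : ℂ) + c) ^ (a : ℂ) - (t : ℂ) ^ (a : ℂ)‖ ≤ K * t ^ (a - 1) := by
  obtain ⟨K, hK, h⟩ := exists_norm_add_mul_cpow_le hc (a - 1)
  refine ⟨|a| * max K 1 * ‖c‖, fun t ht => ?_⟩
  have hmem : ∀ u ∈ Icc (0 : ℝ) 1, (t : ℂ) + u * c ∈ slitPlane := fun u hu => by
    rcases hu.1.eq_or_lt with h0 | h0
    · simpa [← h0] using ht
    · refine add_mem_slitPlane ?_ ht.le
      have : (u : ℂ) * c = u • c := by simp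
      rw [mem_slitPlane_iff] at hc ⊢
      rcases hc with h | h
      · left; rw [this, real_smul, re_ofReal_mul]; positivity
      · right; rw [this, real_smul, im_ofReal_mul]; exact mul_ne_zero h0.ne' h
  have hd : ∀ u ∈ Icc (0 : ℝ) 1, HasDerivWithinAt (fun u : ℝ => ((t : ℂ) + u * c) ^ (a : ℂ))
      (a * ((t : ℂ) + u * c) ^ ((a : ℂ) - 1) * c) (Icc 0 1) u := fun u hu => by
    have h1 : HasDerivAt (fun x : ℂ => (t : ℂ) + x * c) c (u : ℂ) := by
      simpa using ((hasDerivAt_id' (u : ℂ)).mul_const c).const_add (t : ℂ)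
    exact (h1.cpow_const (hmem u hu)).comp_ofReal.hasDerivWithinAt
  have hb : ∀ u ∈ Icc (0 : ℝ) 1, ‖a * ((t : ℂ) + u * c) ^ ((a : ℂ) - 1) * c‖ ≤
      |a| * (max K 1 * t ^ (a - 1)) * ‖c‖ := fun u hu => by
    rw [norm_mul, norm_mul, norm_real, Real.norm_eq_abs]
    gcongr
    rw [show (a : ℂ) - 1 = ((a - 1 : ℝ) : ℂ) by push_cast; rfl]
    rcases hu.1.eq_or_lt with h0 | h0
    · rw [← h0, ofReal_zero, zero_mul, add_zero, norm_cpow_ofReal (by exact_mod_cast ht.ne'),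
        norm_real, Real.norm_of_nonneg ht.le]
      exact le_mul_of_one_le_left (by positivity) (le_max_right _ _)
    · refine (h t u ht.le h0).trans ?_
      gcongr ?_ * ?_
      · exact le_max_left _ _
      · exact Real.rpow_le_rpow_of_nonpos ht (by linarith) (by linarith)
  have := (convex_Icc (0 : ℝ) 1).norm_image_sub_le_of_norm_hasDerivWithin_le hd hb
    (left_mem_Icc.2 zero_le_one) (right_mem_Icc.2 zero_le_one)
  simp only [ofReal_one, one_mul, ofReal_zero, zero_mul, add_zero, sub_zero, norm_one, mul_one] at this
  refine this.trans_eq ?_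
  ring

/-- `powKernel` minus its leading term at infinity. -/
noncomputable def powKernelTail (a g : ℝ) (c : ℂ) (t : ℝ) : ℂ :=
  powKernel a g c t - (t : ℂ) ^ ((a : ℂ) + g - 1)

theorem continuousOn_ofReal_cpow (p : ℂ) : ContinuousOn (fun t : ℝ => (t : ℂ) ^ p) (Ioi 0) :=
  fun t ht =>
    (continuousAt_ofReal_cpow_const t _ (Or.inr (mem_Ioi.1 ht).ne')).continuousWithinAt

theorem exists_norm_powKernelTail_le {a : ℝ} (ha : a < 1) (g : ℝ) {c : ℂ} (hc : c ∈ slitPlane) :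
    ∃ K, ∀ t : ℝ, 0 < t → ‖powKernelTail a g c t‖ ≤ K * t ^ (a + g - 2) := by
  obtain ⟨K, h⟩ := norm_add_cpow_sub_cpow_le ha hc
  refine ⟨K, fun t ht => ?_⟩
  have h0 : (t : ℂ) ≠ 0 := by exact_mod_cast ht.ne'
  rw [powKernelTail, powKernel, show (a : ℂ) + g - 1 = a + (g - 1) by ring, cpow_add _ _ h0,
    ← sub_mul, norm_mul, norm_ofReal_cpow_sub_one g ht, show a + g - 2 = (a - 1) + (g - 1) by ring,
    Real.rpow_add ht, ← mul_assoc]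
  exact mul_le_mul_of_nonneg_right (h t ht) (by positivity)

theorem integrableOn_powKernelTail {a g : ℝ} (hg : 0 < g) (hag : 0 < a + g) (hag1 : a + g < 1)
    {c : ℂ} (hc : c ∈ slitPlane) : IntegrableOn (powKernelTail a g c) (Ioi 0) := by
  obtain ⟨K, h⟩ := exists_norm_powKernelTail_le (a := a) (by linarith) g hc
  have hcont : ContinuousOn (powKernelTail a g c) (Ioi 0) :=
    (continuousOn_powKernel a g hc).sub (continuousOn_ofReal_cpow _)
  rw [← Ioc_union_Ioi_eq_Ioi zero_le_one]
  refine IntegrableOn.union (IntegrableOn.sub ?_ ?_) ?_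
  · have h1 := (laplaceIntegrable_powKernel a hg hc).2 1 one_pos
    refine Integrable.mono' ((h1.mono_set Ioc_subset_Ioi_self).const_mul (Real.exp 1))
      (((continuousOn_powKernel a g hc).mono Ioc_subset_Ioi_self).aestronglyMeasurable
        measurableSet_Ioc) ?_
    filter_upwards [ae_restrict_mem measurableSet_Ioc] with t ht
    rw [← mul_assoc, ← Real.exp_add]
    exact le_mul_of_one_le_left (norm_nonneg _) (Real.one_le_exp (by linarith [ht.2]))
  · refine (intervalIntegrable_iff_integrableOn_Ioc_of_le zero_le_one).1
      (intervalIntegral.intervalIntegrable_cpow' ?_)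
    simpa using hag
  · refine Integrable.mono' ((integrableOn_Ioi_rpow_of_lt (a := a + g - 2) (by linarith)
      one_pos).const_mul K) ((hcont.mono (Ioi_subset_Ioi zero_le_one)).aestronglyMeasurable
        measurableSet_Ioi) ?_
    filter_upwards [ae_restrict_mem measurableSet_Ioi] with t ht
    exact h t (one_pos.trans ht)

/-- Once the non-integrable leading term at infinity is removed, the integral is the value continued
from Euler's formula, since Γ(1 − (a + g)) = −(a + g) Γ(−(a + g)). Integration by parts reduces it
to the exponent a − 1, where the Beta integral converges. -/
theorem integral_powKernelTail {a g : ℝ} (hg : 0 < g) (hag : 0 < a + g) (hag1 : a + g < 1)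
    {c : ℂ} (hc : c ∈ slitPlane) :
    ∫ t in Ioi (0 : ℝ), powKernelTail a g c t =
      -(Gamma g * Gamma (1 - (a + g)) / Gamma (-a) / (a + g) * c ^ ((a : ℂ) + g)) := by
  have i1 := integrableOn_powKernelTail hg hag hag1 hc
  have i2 := integrableOn_powKernel (a := a - 1) hg (by linarith) hc
  have hd : ∀ t ∈ Ioi (0 : ℝ), HasDerivAt
      (fun t : ℝ => powKernel a (g + 1) c t - (t : ℂ) ^ ((a : ℂ) + g))
      ((a + g) * powKernelTail a g c t - a * c * powKernel (a - 1) g c t) t := by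
    intro t ht
    have h1 : HasDerivAt (fun x : ℂ => x ^ ((a : ℂ) + g)) _ (t : ℂ) :=
      (hasDerivAt_id' (t : ℂ)).cpow_const (ofReal_mem_slitPlane.2 ht)
    refine ((hasDerivAt_powKernel a g hc ht).sub h1.comp_ofReal).congr_deriv ?_
    have e1 := powKernel_add_one_left (a - 1) g hc (mem_Ioi.1 ht).le
    rw [sub_add_cancel] at e1
    rw [powKernel_add_one_right _ _ _ ht, powKernelTail, e1]
    ring
  have hne : (a : ℂ) + g ≠ 0 := by exact_mod_cast hag.ne'
  have hcont : ContinuousWithinAt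
      (fun t : ℝ => powKernel a (g + 1) c t - (t : ℂ) ^ ((a : ℂ) + g)) (Ici 0) 0 :=
    (continuousWithinAt_powKernel_zero a hg hc).sub
      (continuousAt_ofReal_cpow_const 0 _ (Or.inl (by simpa using hag))).continuousWithinAt
  have hlim : Tendsto (fun t : ℝ => powKernel a (g + 1) c t - (t : ℂ) ^ ((a : ℂ) + g))
      atTop (𝓝 0) := by
    obtain ⟨K, h⟩ := exists_norm_powKernelTail_le (a := a) (by linarith) (g + 1) hc
    have h1 : Tendsto (fun t : ℝ => K * t ^ (a + g - 1)) atTop (𝓝 0) := by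
      simpa using (tendsto_rpow_neg_atTop (y := -(a + g - 1)) (by linarith)).const_mul K
    refine squeeze_zero_norm' ?_ h1
    filter_upwards [eventually_gt_atTop 0] with t ht
    have h2 := h t ht
    rw [powKernelTail, show (a : ℂ) + (g + 1 : ℝ) - 1 = a + g by push_cast; ring,
      show a + (g + 1) - 2 = a + g - 1 by ring] at h2
    exact h2
  have h := integral_Ioi_of_hasDerivAt_of_tendsto hcont hd
    ((i1.const_mul _).sub (i2.const_mul _)) hlim
  rw [integral_sub (i1.const_mul _) (i2.const_mul _), integral_const_mul, integral_const_mul,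
    powKernel_zero a hg, ofReal_zero, zero_cpow hne, integral_powKernel hg (by linarith) hc] at h
  have e1 := Gamma_inv_step (-a)
  rw [show -(a : ℂ) + 1 = 1 - a by ring] at e1
  have e2 : c ^ (((a - 1 : ℝ) : ℂ) + g) * c = c ^ ((a : ℂ) + g) := by
    rw [show (a : ℂ) + g = ((a - 1 : ℝ) : ℂ) + g + 1 by push_cast; ring,
      cpow_add (((a - 1 : ℝ) : ℂ) + g) 1 (slitPlane_ne_zero hc), cpow_one]
  rw [show -(((a - 1 : ℝ) : ℂ) + g) = 1 - (a + g) by push_cast; ring,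
    show -((a - 1 : ℝ) : ℂ) = 1 - a by push_cast; ring] at h
  simp only [div_eq_mul_inv]
  rw [e1, ← e2]
  field_simp
  rw [div_eq_mul_inv] at h
  linear_combination h

/-- Both limits hold by dominated convergence with majorant ‖f‖. The second uses x e^(−x) ≤ 1 at x =
st. -/
theorem tendsto_laplace_nhdsGT {f : ℝ → ℂ} (hf : IntegrableOn f (Ioi 0)) :
    Tendsto (fun s : ℝ => ∫ t in Ioi (0 : ℝ), f t * cexp (-s * t)) (𝓝[>] 0)
        (𝓝 (∫ t in Ioi (0 : ℝ), f t)) ∧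
      Tendsto (fun s : ℝ => s * ∫ t in Ioi (0 : ℝ), t * f t * cexp (-s * t)) (𝓝[>] 0) (𝓝 0) := by
  have hexp : ∀ s t : ℝ, ‖cexp (-s * t)‖ = Real.exp (-(s * t)) := fun s t => by
    rw [norm_exp_neg_mul, ofReal_re]
  constructor
  · refine tendsto_integral_filter_of_dominated_convergence (fun t => ‖f t‖) ?_ ?_ hf.norm ?_
    · exact Eventually.of_forall fun s =>
        hf.aestronglyMeasurable.mul (aestronglyMeasurable_exp_neg_mul s _)
    · filter_upwards [self_mem_nhdsWithin] with s hs
      filter_upwards [ae_restrict_mem measurableSet_Ioi] with t ht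
      rw [norm_mul, hexp]
      refine mul_le_of_le_one_right (norm_nonneg _) (Real.exp_le_one_iff.2 ?_)
      have := mul_pos (mem_Ioi.1 hs) (mem_Ioi.1 ht)
      linarith
    · refine Eventually.of_forall fun t => ?_
      have h1 : Continuous fun s : ℝ => f t * cexp (-s * t) := by fun_prop
      simpa using (h1.tendsto 0).mono_left nhdsWithin_le_nhds
  · have h0 : (fun s : ℝ => s * ∫ t in Ioi (0 : ℝ), t * f t * cexp (-s * t)) =
        fun s : ℝ => ∫ t in Ioi (0 : ℝ), s * (t * f t * cexp (-s * t)) := by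
      funext s; rw [integral_const_mul]
    rw [h0, show (0 : ℂ) = ∫ t in Ioi (0 : ℝ), (0 : ℂ) by simp]
    refine tendsto_integral_filter_of_dominated_convergence (fun t => ‖f t‖) ?_ ?_ hf.norm ?_
    · exact Eventually.of_forall fun s =>
        ((continuous_ofReal.aestronglyMeasurable.mul hf.aestronglyMeasurable).mul
          (aestronglyMeasurable_exp_neg_mul s _)).const_mul _
    · filter_upwards [self_mem_nhdsWithin] with s hs
      filter_upwards [ae_restrict_mem measurableSet_Ioi] with t ht
      have hs0 : 0 < s := hs
      have ht0 : 0 < t := ht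
      rw [norm_mul, norm_mul, norm_mul, hexp, norm_real, norm_real, Real.norm_of_nonneg hs0.le,
        Real.norm_of_nonneg ht0.le]
      have h2 : s * t * Real.exp (-(s * t)) ≤ 1 := by
        rw [Real.exp_neg, ← div_eq_mul_inv, div_le_one (Real.exp_pos _)]
        linarith [Real.add_one_le_exp (s * t)]
      calc _ = (s * t * Real.exp (-(s * t))) * ‖f t‖ := by ring
        _ ≤ 1 * ‖f t‖ := by gcongr
        _ = _ := one_mul _
    · refine Eventually.of_forall fun t => ?_
      have h1 : Continuous fun s : ℝ => s * (t * f t * cexp (-s * t)) := by fun_prop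
      simpa using (h1.tendsto 0).mono_left nhdsWithin_le_nhds

theorem integrableOn_cpow_mul_exp {p s : ℝ} (hp : 0 < p) (hs : 0 < s) :
    IntegrableOn (fun t : ℝ => (t : ℂ) ^ ((p : ℂ) - 1) * cexp (-s * t)) (Ioi 0) := by
  have h1 := (laplaceIntegrable_powKernel 0 hp one_mem_slitPlane).integrableOn (s := s) (by simpa)
  refine h1.congr_fun (fun t _ => ?_) measurableSet_Ioi
  simp [powKernel]

theorem integral_cpow_mul_exp {p s : ℝ} (hp : 0 < p) (hs : 0 < s) :
    ∫ t in Ioi (0 : ℝ), (t : ℂ) ^ ((p : ℂ) - 1) * cexp (-s * t) = Gamma p * (s : ℂ) ^ (-(p : ℂ)) := by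
  have h := integral_cpow_mul_exp_neg_mul_Ioi (a := p) (by simpa using hp) hs
  rw [one_div, inv_cpow _ _ (by rw [arg_ofReal_of_nonneg hs.le]; exact Real.pi_pos.ne),
    ← cpow_neg] at h
  simp only [neg_mul]
  rw [h, mul_comm]

theorem laplacePow_eq_tail {a g : ℝ} (hg : 0 < g) (hag : 0 < a + g) {c : ℂ} (hc : c ∈ slitPlane)
    {s : ℝ} (hs : 0 < s) :
    laplacePow a g c s - Gamma (a + g) * (s : ℂ) ^ (-((a : ℂ) + g)) =
      ∫ t in Ioi (0 : ℝ), powKernelTail a g c t * cexp (-s * t) := by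
  have h1 := (laplaceIntegrable_powKernel a hg hc).integrableOn (s := s) (by simpa)
  have h2 := integrableOn_cpow_mul_exp hag hs
  have h3 := integral_cpow_mul_exp hag hs
  push_cast at h2 h3
  rw [← h3, laplacePow, ← integral_sub h1 h2]
  simp only [powKernelTail, sub_mul]

/-- The subtracted term is exactly the Laplace transform of the leading power, so only the
integrable tail is left. The second limit uses that raising g multiplies the tail by t. -/
theorem tendsto_laplacePow {a g : ℝ} (hg : 0 < g) (hag : 0 < a + g) (hag1 : a + g < 1)
    {c : ℂ} (hc : c ∈ slitPlane) :
    Tendsto (fun s : ℝ => laplacePow a g c s - Gamma (a + g) * (s : ℂ) ^ (-((a : ℂ) + g))) (𝓝[>] 0)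
        (𝓝 (-(Gamma g * Gamma (1 - (a + g)) / Gamma (-a) / (a + g) * c ^ ((a : ℂ) + g)))) ∧
      Tendsto (fun s : ℝ => s * laplacePow a (g + 1) c s -
        Gamma (a + g + 1) * (s : ℂ) ^ (-((a : ℂ) + g))) (𝓝[>] 0) (𝓝 0) := by
  obtain ⟨h1, h2⟩ := tendsto_laplace_nhdsGT (integrableOn_powKernelTail hg hag hag1 hc)
  rw [integral_powKernelTail hg hag hag1 hc] at h1
  constructor
  · refine h1.congr' ?_
    filter_upwards [self_mem_nhdsWithin] with s hs
    rw [laplacePow_eq_tail hg hag hc hs]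
  · refine h2.congr' ?_
    filter_upwards [self_mem_nhdsWithin] with s hs
    have hs0 : (s : ℂ) ≠ 0 := by exact_mod_cast (mem_Ioi.1 hs).ne'
    have h3 := laplacePow_eq_tail (a := a) (g := g + 1) (by linarith) (by linarith) hc hs
    have h4 : (s : ℂ) ^ (-((a : ℂ) + g)) = s * (s : ℂ) ^ (-((a : ℂ) + (g + 1 : ℝ))) := by
      rw [show -((a : ℂ) + g) = -((a : ℂ) + (g + 1 : ℝ)) + 1 by push_cast; ring, cpow_add _ _ hs0,
        cpow_one]
      ring
    have h5 : ∫ t in Ioi (0 : ℝ), powKernelTail a (g + 1) c t * cexp (-s * t) =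
        ∫ t in Ioi (0 : ℝ), t * powKernelTail a g c t * cexp (-s * t) := by
      refine setIntegral_congr_fun measurableSet_Ioi fun t ht => ?_
      have ht0 : (t : ℂ) ≠ 0 := by exact_mod_cast (mem_Ioi.1 ht).ne'
      simp only [powKernelTail]
      rw [powKernel_add_one_right a g c ht,
        show (a : ℂ) + (g + 1 : ℝ) - 1 = a + g - 1 + 1 by push_cast; ring, cpow_add _ _ ht0,
        cpow_one]
      ring
    rw [← h5, ← h3, h4, show (a : ℂ) + g + 1 = a + (g + 1 : ℝ) by push_cast; ring]
    ring

/-! ### Two solutions of Kummer's equation and Abel's identity. -/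

/-- The solution `s ^ (-b) ₁F₁(-a; 1 - b; c s) / Γ(1 - b)` of Kummer's equation. -/
noncomputable def kummerFst (a b c s : ℂ) : ℂ :=
  s ^ (-b) * regularizedHGFun {-a} {1 - b} (c * s)

/-- The solution `c ^ b ₁F₁(b - a; 1 + b; c s) / Γ(1 + b)` of Kummer's equation. -/
noncomputable def kummerSnd (a b c s : ℂ) : ℂ :=
  c ^ b * regularizedHGFun {b - a} {1 + b} (c * s)

theorem regularizedHGFun_mul_hasDerivAt (a b c s : ℂ) :
    HasDerivAt (fun s => regularizedHGFun {a} {b} (c * s))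
      (c * (a * regularizedHGFun {a + 1} {b + 1} (c * s))) s := by
  have h : HasDerivAt (fun s => c * s) c s := by simpa using (hasDerivAt_id' s).const_mul c
  exact ((regularizedHGFun_hasDerivAt a b (c * s)).comp s h).congr_deriv (by ring)

theorem kummerFst_hasDerivAt (a b c : ℂ) {s : ℂ} (hs : s ∈ slitPlane) :
    HasDerivAt (kummerFst a b c) (kummerFst a (b + 1) c s) s := by
  have h1 : HasDerivAt (fun s : ℂ => s ^ (-b)) _ s := (hasDerivAt_id' s).cpow_const hs
  refine (h1.mul (regularizedHGFun_mul_hasDerivAt (-a) (1 - b) c s)).congr_deriv ?_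
  have h2 := (regularizedHGFun_contiguous (-a) (1 - b) (c * s)).1
  have hs0 := slitPlane_ne_zero hs
  have h3 : s ^ (-b) = s ^ (-b - 1) * s := by
    rw [cpow_sub _ _ hs0, cpow_one]; field_simp
  rw [kummerFst, show 1 - (b + 1) = 1 - b - 1 by ring, ← h2, show -(b + 1) = -b - 1 by ring, h3]
  ring

theorem kummerSnd_hasDerivAt (a b : ℂ) {c : ℂ} (hc : c ≠ 0) (s : ℂ) :
    HasDerivAt (kummerSnd a b c) ((b - a) * kummerSnd a (b + 1) c s) s := by
  refine ((regularizedHGFun_mul_hasDerivAt (b - a) (1 + b) c s).const_mul (c ^ b)).congr_deriv ?_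
  rw [kummerSnd, cpow_add _ _ hc, cpow_one, show b + 1 - a = b - a + 1 by ring,
    show 1 + (b + 1) = 1 + b + 1 by ring]
  ring

theorem kummerFst_kummer (a b c : ℂ) {s : ℂ} (hs : s ≠ 0) :
    s * kummerFst a (b + 1 + 1) c s + (1 + b - c * s) * kummerFst a (b + 1) c s
      - (b - a) * c * kummerFst a b c s = 0 := by
  have h1 := (regularizedHGFun_contiguous (-a) (-b) (c * s)).1
  obtain ⟨h2, h3⟩ := regularizedHGFun_contiguous (-a) (-b + 1) (c * s)
  rw [add_sub_cancel_right] at h2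
  have e1 : s ^ (-(b + 1 + 1)) * s = s ^ (-(b + 1)) := by
    rw [show -(b + 1) = -(b + 1 + 1) + 1 by ring, cpow_add _ _ hs, cpow_one]
  have e2 : s ^ (-b) = s ^ (-(b + 1)) * s := by
    rw [show -b = -(b + 1) + 1 by ring, cpow_add _ _ hs, cpow_one]
  simp only [kummerFst]
  rw [show 1 - (b + 1 + 1) = -b - 1 by ring, show 1 - (b + 1) = -b by ring,
    show 1 - b = -b + 1 by ring, e2]
  linear_combination e1 * regularizedHGFun {-a} {-b - 1} (c * s) +
    s ^ (-(b + 1)) * (-h1 + c * s * (h2 - h3))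

theorem kummerSnd_kummer (a b : ℂ) {c : ℂ} (hc : c ≠ 0) (s : ℂ) :
    s * ((b - a) * ((b + 1 - a) * kummerSnd a (b + 1 + 1) c s)) +
      (1 + b - c * s) * ((b - a) * kummerSnd a (b + 1) c s)
      - (b - a) * c * kummerSnd a b c s = 0 := by
  have h1 := (regularizedHGFun_contiguous (b - a + 1) (1 + b + 1) (c * s)).1
  have h2 := (regularizedHGFun_contiguous (b - a) (1 + b) (c * s)).2
  simp only [kummerSnd]
  rw [cpow_add _ _ hc, cpow_add _ _ hc, cpow_one, show b + 1 + 1 - a = b - a + 1 + 1 by ring,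
    show b + 1 - a = b - a + 1 by ring, show 1 + (b + 1 + 1) = 1 + b + 1 + 1 by ring,
    show 1 + (b + 1) = 1 + b + 1 by ring]
  rw [add_sub_cancel_right] at h1
  linear_combination (b - a) * c ^ b * c * h1 - c ^ b * c * h2

/-- This plays the role of an initial condition at the singular point 0, where only one-sided limits
are available. -/
theorem eq_of_hasDerivAt_zero_of_tendsto {f : ℝ → ℂ} {l : ℂ} {R : ℝ}
    (hf : ∀ s ∈ Ioo 0 R, HasDerivAt f 0 s) (hl : Tendsto f (𝓝[>] 0) (𝓝 l)) {s : ℝ}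
    (hs : s ∈ Ioo 0 R) : f s = l := by
  have h : ∀ x ∈ Ioo 0 R, f s = f x := fun x hx =>
    isOpen_Ioo.is_const_of_deriv_eq_zero isPreconnected_Ioo
      (fun x hx => (hf x hx).differentiableAt.differentiableWithinAt)
      (fun x hx => (hf x hx).deriv) hs hx
  refine tendsto_nhds_unique (tendsto_const_nhds.congr' ?_) hl
  filter_upwards [Ioo_mem_nhdsGT (hs.1.trans hs.2)] with x hx using h x hx

/-- Abel's identity for Kummer's equation `s u'' + (b - c s) u' = l u` on `(0, ∞)`. -/
theorem wronskian_eq {b c l L : ℂ} {u u₁ u₂ v v₁ v₂ : ℝ → ℂ}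
    (hu : ∀ s > 0, HasDerivAt u (u₁ s) s) (hu₁ : ∀ s > 0, HasDerivAt u₁ (u₂ s) s)
    (hv : ∀ s > 0, HasDerivAt v (v₁ s) s) (hv₁ : ∀ s > 0, HasDerivAt v₁ (v₂ s) s)
    (eu : ∀ s : ℝ, 0 < s → s * u₂ s + (b - c * s) * u₁ s - l * u s = 0)
    (ev : ∀ s : ℝ, 0 < s → s * v₂ s + (b - c * s) * v₁ s - l * v s = 0)
    (hL : Tendsto (fun s : ℝ => (s : ℂ) ^ b * (u s * v₁ s - u₁ s * v s)) (𝓝[>] 0) (𝓝 L))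
    {s : ℝ} (hs : 0 < s) :
    (s : ℂ) ^ b * cexp (-(c * s)) * (u s * v₁ s - u₁ s * v s) = L := by
  have hlim : Tendsto (fun s : ℝ => (s : ℂ) ^ b * cexp (-(c * s)) * (u s * v₁ s - u₁ s * v s))
      (𝓝[>] 0) (𝓝 L) := by
    have h1 : Continuous fun s : ℝ => cexp (-(c * s)) := by fun_prop
    have h2 := ((h1.tendsto 0).mono_left (nhdsWithin_le_nhds (s := Ioi 0))).mul hL
    simp only [ofReal_zero, mul_zero, neg_zero, Complex.exp_zero, one_mul] at h2
    exact h2.congr fun s => by ring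
  refine eq_of_hasDerivAt_zero_of_tendsto (R := s + 1) (fun x hx => ?_) hlim ⟨hs, by linarith⟩
  have hx0 : (x : ℂ) ≠ 0 := by exact_mod_cast hx.1.ne'
  have h1 : HasDerivAt (fun s : ℂ => s ^ b) _ (x : ℂ) :=
    (hasDerivAt_id' (x : ℂ)).cpow_const (ofReal_mem_slitPlane.2 hx.1)
  have h2 : HasDerivAt (fun s : ℂ => cexp (-(c * s))) (cexp (-(c * x)) * (-c)) (x : ℂ) := by
    have h3 : HasDerivAt (fun s : ℂ => -(c * s)) (-c) (x : ℂ) := by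
      simpa using ((hasDerivAt_id' (x : ℂ)).const_mul c).fun_neg
    exact h3.cexp
  refine ((h1.mul h2).comp_ofReal.mul (((hu x hx.1).mul (hv₁ x hx.1)).sub
    ((hu₁ x hx.1).mul (hv x hx.1)))).congr_deriv ?_
  have e1 := eu x hx.1
  have e2 := ev x hx.1
  rw [cpow_sub _ _ hx0, cpow_one]
  simp only [Pi.mul_apply, Pi.sub_apply]
  generalize cexp (-(c * x)) = E
  field_simp
  linear_combination E * (x : ℂ) ^ b * (u x * e2 - v x * e1)

theorem tendsto_ofReal_cpow_nhdsGT {p : ℂ} (hp : 0 < p.re) :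
    Tendsto (fun s : ℝ => (s : ℂ) ^ p) (𝓝[>] 0) (𝓝 0) := by
  have h := (continuousAt_ofReal_cpow_const 0 p (Or.inl hp)).tendsto
  have hp0 : p ≠ 0 := by rintro rfl; simp at hp
  rw [ofReal_zero, zero_cpow hp0] at h
  exact h.mono_left nhdsWithin_le_nhds

theorem tendsto_regularizedHGFun_nhdsGT (a b c : ℂ) :
    Tendsto (fun s : ℝ => regularizedHGFun {a} {b} (c * s)) (𝓝[>] 0) (𝓝 (Gamma b)⁻¹) := by
  have h := (regularizedHGFun_mul_hasDerivAt a b c (0 : ℝ)).comp_ofReal.continuousAt.tendsto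
  simp only [ofReal_zero, mul_zero, regularizedHGFun_zero] at h
  exact h.mono_left nhdsWithin_le_nhds

/-- The expression is s^(1−p) times a difference quotient at 0, which converges to the derivative.
-/
theorem tendsto_cpow_mul_sub_nhdsGT {p : ℂ} (hp : p.re < 1) (a b c : ℂ) :
    Tendsto (fun s : ℝ => (s : ℂ) ^ (-p) * (regularizedHGFun {a} {b} (c * s) - (Gamma b)⁻¹))
      (𝓝[>] 0) (𝓝 0) := by
  have h := (regularizedHGFun_mul_hasDerivAt a b c (0 : ℝ)).comp_ofReal
  rw [hasDerivAt_iff_tendsto_slope] at h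
  have h1 := (tendsto_ofReal_cpow_nhdsGT (p := 1 - p) (by simpa using hp)).mul
    (h.mono_left (nhdsWithin_mono _ fun x hx => (mem_Ioi.1 hx).ne'))
  rw [zero_mul] at h1
  refine h1.congr' ?_
  filter_upwards [self_mem_nhdsWithin] with s hs
  have hs0 : (s : ℂ) ≠ 0 := by exact_mod_cast (mem_Ioi.1 hs).ne'
  rw [slope_def_module, show 1 - p = -p + 1 by ring, cpow_add _ _ hs0, cpow_one, ofReal_zero,
    mul_zero, regularizedHGFun_zero, sub_zero, real_smul, ofReal_inv]
  field_simp

theorem ofReal_ne_neg_nat {b : ℝ} (hb : ∀ n : ℤ, b ≠ n) (n : ℕ) : (b : ℂ) ≠ -n := by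
  have := hb (-n)
  push_cast at this
  exact_mod_cast this

theorem Gamma_ofReal_ne_zero {b : ℝ} (hb : ∀ n : ℤ, b ≠ n) : Gamma (b : ℂ) ≠ 0 :=
  Gamma_ne_zero (ofReal_ne_neg_nat hb)

theorem forall_ne_int_neg {b : ℝ} (hb : ∀ n : ℤ, b ≠ n) : ∀ n : ℤ, -b ≠ n := fun n h =>
  hb (-n) (by push_cast; linarith)

theorem forall_ne_int_add_one {b : ℝ} (hb : ∀ n : ℤ, b ≠ n) : ∀ n : ℤ, b + 1 ≠ n := fun n h =>
  hb (n - 1) (by push_cast; linarith)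

theorem sin_pi_mul_add_one (b : ℂ) :
    Complex.sin (Real.pi * (b + 1)) = -Complex.sin (Real.pi * b) := by
  rw [mul_add, mul_one, Complex.sin_add_pi]

/-! ### Identification of the Laplace transform. -/

/-- The Laplace transform of `powKernel` in terms of Kummer functions. -/
noncomputable def kummerLaplace (a g : ℝ) (c s : ℂ) : ℂ :=
  Real.pi / Complex.sin (Real.pi * (a + g)) *
    (kummerFst a (a + g) c s - Gamma g / Gamma (-a) * kummerSnd a (a + g) c s)

/-- The coefficients are such that this mirrors `laplacePow_hasDerivAt`: raising g by one changes
the sign of sin π(a + g), and Γ(g + 1) = g Γ(g) supplies the factor from `kummerSnd`. -/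
theorem kummerLaplace_hasDerivAt (a : ℝ) {g : ℝ} (hg : 0 < g) {c s : ℂ} (hc : c ≠ 0)
    (hs : s ∈ slitPlane) :
    HasDerivAt (kummerLaplace a g c) (-kummerLaplace a (g + 1) c s) s := by
  have hg0 : (g : ℂ) ≠ 0 := by exact_mod_cast hg.ne'
  refine (((kummerFst_hasDerivAt a (a + g) c hs).sub
    ((kummerSnd_hasDerivAt a (a + g) hc s).const_mul (Gamma g / Gamma (-a)))).const_mul
      _).congr_deriv ?_
  rw [kummerLaplace, show (a : ℂ) + (g + 1 : ℝ) = a + g + 1 by push_cast; ring,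
    sin_pi_mul_add_one, ofReal_add, ofReal_one, Gamma_add_one _ hg0, div_neg]
  ring

theorem kummerLaplace_kummer (a : ℝ) {g : ℝ} (hg : 0 < g) {c s : ℂ} (hc : c ≠ 0) (hs : s ≠ 0) :
    s * kummerLaplace a (g + 1 + 1) c s - (1 + (a + g) - c * s) * kummerLaplace a (g + 1) c s
      - g * c * kummerLaplace a g c s = 0 := by
  have hg0 : (g : ℂ) ≠ 0 := by exact_mod_cast hg.ne'
  have hg1 : (g : ℂ) + 1 ≠ 0 := by exact_mod_cast (by linarith : g + 1 ≠ 0)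
  have h1 := kummerFst_kummer a (a + g) c hs
  have h2 := kummerSnd_kummer a (a + g) hc s
  simp only [kummerLaplace]
  rw [show (a : ℂ) + (g + 1 + 1 : ℝ) = a + g + 1 + 1 by push_cast; ring,
    show (a : ℂ) + (g + 1 : ℝ) = a + g + 1 by push_cast; ring, sin_pi_mul_add_one,
    sin_pi_mul_add_one, neg_neg, ofReal_add, ofReal_add, ofReal_one, Gamma_add_one _ hg1,
    Gamma_add_one _ hg0, div_neg]
  linear_combination Real.pi / Complex.sin (Real.pi * (a + g)) *
    (h1 - Gamma g / Gamma (-a) * h2)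

theorem kummerSnd_tendsto (a b c : ℂ) :
    Tendsto (fun s : ℝ => kummerSnd a b c s) (𝓝[>] 0) (𝓝 (c ^ b * (Gamma (1 + b))⁻¹)) :=
  (tendsto_regularizedHGFun_nhdsGT (b - a) (1 + b) c).const_mul _

theorem tendsto_ofReal_nhdsGT_zero : Tendsto (fun s : ℝ => (s : ℂ)) (𝓝[>] 0) (𝓝 0) := by
  simpa using (continuous_ofReal.tendsto 0).mono_left (nhdsWithin_le_nhds (s := Ioi 0))

theorem cpow_mul_kummerFst (a b c : ℂ) {s : ℝ} (hs : 0 < s) :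
    (s : ℂ) ^ (1 + b) * kummerFst a b c s = s * regularizedHGFun {-a} {1 - b} (c * s) ∧
    (s : ℂ) ^ (1 + b) * kummerFst a (b + 1) c s = regularizedHGFun {-a} {-b} (c * s) := by
  have hs0 : (s : ℂ) ≠ 0 := by exact_mod_cast hs.ne'
  constructor
  · rw [kummerFst, ← mul_assoc, ← cpow_add _ _ hs0]
    simp
  · rw [kummerFst, ← mul_assoc, ← cpow_add _ _ hs0, show 1 - (b + 1) = -b by ring,
      show 1 + b + -(b + 1) = 0 by ring, cpow_zero, one_mul]

/-- Write b = a + g. Since π / sin(πb) = Γ(b) Γ(1 − b), the leading term of `kummerFst` contributes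
Γ(b) s^(−b), the singular part of the Laplace transform. The constant contributed by `kummerSnd`
matches the integral of the tail. -/
theorem laplacePow_sub_kummerLaplace_tendsto {a g : ℝ} (hg : 0 < g) (hag : 0 < a + g)
    (hag1 : a + g < 1) {c : ℂ} (hc : c ∈ slitPlane) :
    Tendsto (fun s : ℝ => laplacePow a g c s - kummerLaplace a g c s) (𝓝[>] 0) (𝓝 0) ∧
      Tendsto (fun s : ℝ => s * (laplacePow a (g + 1) c s - kummerLaplace a (g + 1) c s))
        (𝓝[>] 0) (𝓝 0) := by
  obtain ⟨l1, l2⟩ := tendsto_laplacePow hg hag hag1 hc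
  have hb0 : (a : ℂ) + g ≠ 0 := by exact_mod_cast hag.ne'
  have hg0 : (g : ℂ) ≠ 0 := by exact_mod_cast hg.ne'
  have hint : ∀ n : ℤ, a + g ≠ n := by
    rintro n hn
    rw [hn] at hag hag1
    norm_cast at hag hag1
    omega
  have hG : Gamma ((a : ℂ) + g) ≠ 0 := by exact_mod_cast Gamma_ofReal_ne_zero hint
  have hG1 : Gamma (1 - ((a : ℂ) + g)) ≠ 0 := by
    have := Gamma_ofReal_ne_zero (forall_ne_int_add_one (forall_ne_int_neg hint))
    push_cast at this
    rwa [show (1 : ℂ) - (a + g) = -(a + g) + 1 by ring]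
  have hk := Gamma_mul_Gamma_one_sub ((a : ℂ) + g)
  constructor
  · have m1 := tendsto_cpow_mul_sub_nhdsGT (p := (a : ℂ) + g) (by simpa using hag1) (-a)
      (1 - (a + g)) c
    have m2 := kummerSnd_tendsto a (a + g) c
    have := (l1.sub (m1.const_mul (Gamma ((a : ℂ) + g) * Gamma (1 - ((a : ℂ) + g))))).add
      (m2.const_mul (Gamma ((a : ℂ) + g) * Gamma (1 - ((a : ℂ) + g)) * (Gamma g / Gamma (-a))))
    convert this using 2 with s
    · rw [kummerLaplace, ← hk, kummerFst]
      field_simp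
      ring
    · rw [add_comm 1 ((a : ℂ) + g), Gamma_add_one _ hb0]
      field_simp
      ring
  · have m1 := tendsto_cpow_mul_sub_nhdsGT (p := (a : ℂ) + g) (by simpa using hag1) (-a)
      (-(a + g)) c
    have m2 := tendsto_ofReal_nhdsGT_zero.mul (kummerSnd_tendsto a (a + g + 1) c)
    have := (l2.add (m1.const_mul (Gamma ((a : ℂ) + g) * Gamma (1 - ((a : ℂ) + g))))).sub
      (m2.const_mul (Gamma ((a : ℂ) + g) * Gamma (1 - ((a : ℂ) + g)) * (Gamma g * g / Gamma (-a))))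
    rw [mul_zero, zero_mul, mul_zero, sub_zero, add_zero] at this
    refine this.congr' ?_
    filter_upwards [self_mem_nhdsWithin] with s hs
    have hs0 : (s : ℂ) ≠ 0 := by exact_mod_cast (mem_Ioi.1 hs).ne'
    have e1 : Gamma (1 - ((a : ℂ) + g)) * (Gamma (-((a : ℂ) + g)))⁻¹ = -(a + g) := by
      rw [Gamma_inv_step, show -((a : ℂ) + g) + 1 = 1 - (a + g) by ring]
      field_simp
    have e2 : (s : ℂ) ^ (-((a : ℂ) + g + 1)) * s = (s : ℂ) ^ (-((a : ℂ) + g)) := by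
      rw [show -((a : ℂ) + g) = -(a + g + 1) + 1 by ring, cpow_add _ _ hs0, cpow_one]
    rw [kummerLaplace, show (a : ℂ) + (g + 1 : ℝ) = a + g + 1 by push_cast; ring,
      sin_pi_mul_add_one, div_neg, ← hk, kummerFst, ofReal_add, ofReal_one, Gamma_add_one _ hg0,
      Gamma_add_one _ hb0, ← e2, show 1 - ((a : ℂ) + g + 1) = -(a + g) by ring]
    linear_combination (-Gamma ((a : ℂ) + g) * ((s : ℂ) ^ (-((a : ℂ) + g + 1)) * s)) * e1

/-- Let D be the difference and F, S the two Kummer solutions. The limits of D and s D' force W(F,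
D) = W(S, D) = 0, whereas W(F, S) ≠ 0 because a + g is not an integer. The identity D W(F, S) = S
W(F, D) − F W(S, D) then gives D = 0. -/
theorem laplacePow_eq_of_pos {a g : ℝ} (hg : 0 < g) (hag : 0 < a + g)
    (hag1 : a + g < 1) {c : ℂ} (hc : c ∈ slitPlane) {s : ℝ} (hs : 0 < s) :
    laplacePow a g c s = kummerLaplace a g c s := by
  obtain ⟨l1, l2⟩ := laplacePow_sub_kummerLaplace_tendsto hg hag hag1 hc
  have hc0 := slitPlane_ne_zero hc
  have hint : ∀ n : ℤ, a + g ≠ n := by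
    rintro n hn
    rw [hn] at hag hag1
    norm_cast at hag hag1
    omega
  have hre : ∀ s : ℝ, 0 < s → 0 < (s : ℂ).re := fun s hs => by simpa
  have dD : ∀ g : ℝ, 0 < g → ∀ s : ℝ, s > 0 → HasDerivAt
      (fun s : ℝ => laplacePow a g c s - kummerLaplace a g c s)
      (-(laplacePow a (g + 1) c s - kummerLaplace a (g + 1) c s)) s := fun g hg s hs =>
    (((laplacePow_hasDerivAt a hg hc (hre s hs)).sub (kummerLaplace_hasDerivAt a hg hc0
      (ofReal_mem_slitPlane.2 hs))).comp_ofReal).congr_deriv (by ring)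
  have dD1 : ∀ s : ℝ, s > 0 → HasDerivAt
      (fun s : ℝ => -(laplacePow a (g + 1) c s - kummerLaplace a (g + 1) c s))
      (laplacePow a (g + 1 + 1) c s - kummerLaplace a (g + 1 + 1) c s) s := fun s hs => by
    simpa using (dD (g + 1) (by linarith) s hs).fun_neg
  have eD : ∀ s : ℝ, 0 < s → s * (laplacePow a (g + 1 + 1) c s - kummerLaplace a (g + 1 + 1) c s) +
      ((1 + (a + g)) - c * s) * -(laplacePow a (g + 1) c s - kummerLaplace a (g + 1) c s) -
      (g * c) * (laplacePow a g c s - kummerLaplace a g c s) = 0 := fun s hs => by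
    have hs0 : (s : ℂ) ≠ 0 := by exact_mod_cast hs.ne'
    linear_combination laplacePow_kummer a hg hc (hre s hs) - kummerLaplace_kummer a hg hc0 hs0
  have dF : ∀ b : ℂ, ∀ s : ℝ, s > 0 → HasDerivAt (fun s : ℝ => kummerFst a b c s)
      (kummerFst a (b + 1) c s) s := fun b s hs =>
    (kummerFst_hasDerivAt a b c (ofReal_mem_slitPlane.2 hs)).comp_ofReal
  have eF : ∀ s : ℝ, 0 < s → s * kummerFst a (a + g + 1 + 1) c s +
      ((1 + (a + g)) - c * s) * kummerFst a (a + g + 1) c s - (g * c) * kummerFst a (a + g) c s = 0 :=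
    fun s hs => by
      have hs0 : (s : ℂ) ≠ 0 := by exact_mod_cast hs.ne'
      linear_combination kummerFst_kummer a (a + g) c hs0
  have dS : ∀ s : ℝ, s > 0 → HasDerivAt (fun s : ℝ => kummerSnd a (a + g) c s)
      (g * kummerSnd a (a + g + 1) c s) s := fun s hs =>
    ((kummerSnd_hasDerivAt a (a + g) hc0 s).comp_ofReal).congr_deriv (by ring)
  have dS1 : ∀ s : ℝ, s > 0 → HasDerivAt (fun s : ℝ => g * kummerSnd a (a + g + 1) c s)
      (g * ((g + 1) * kummerSnd a (a + g + 1 + 1) c s)) s := fun s hs =>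
    (((kummerSnd_hasDerivAt a (a + g + 1) hc0 s).comp_ofReal).const_mul _).congr_deriv (by ring)
  have eS : ∀ s : ℝ, 0 < s → s * (g * ((g + 1) * kummerSnd a (a + g + 1 + 1) c s)) +
      ((1 + (a + g)) - c * s) * (g * kummerSnd a (a + g + 1) c s) -
      (g * c) * kummerSnd a (a + g) c s = 0 := fun s hs => by
    linear_combination kummerSnd_kummer a (a + g) hc0 s
  have tS := kummerSnd_tendsto a (a + g) c
  have tS1 := kummerSnd_tendsto a (a + g + 1) c
  have tF := tendsto_regularizedHGFun_nhdsGT (-a) (1 - (a + g)) c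
  have tF1 := tendsto_regularizedHGFun_nhdsGT (-a) (-(a + g)) c
  have tb : Tendsto (fun s : ℝ => (s : ℂ) ^ ((a : ℂ) + g)) (𝓝[>] 0) (𝓝 0) :=
    tendsto_ofReal_cpow_nhdsGT (by simpa using hag)
  have wFD := wronskian_eq (L := 0) (dF (a + g)) (dF (a + g + 1)) (dD g hg) dD1 eF eD (by
    have h := ((tF.mul l2).add (tF1.mul l1)).neg
    simp only [mul_zero, add_zero, neg_zero] at h
    refine h.congr' ?_
    filter_upwards [self_mem_nhdsWithin] with s hs
    obtain ⟨e1, e2⟩ := cpow_mul_kummerFst a (a + g) c hs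
    linear_combination (laplacePow a (g + 1) c s - kummerLaplace a (g + 1) c s) * e1 +
      (laplacePow a g c s - kummerLaplace a g c s) * e2) hs
  have wSD := wronskian_eq (L := 0) dS dS1 (dD g hg) dD1 eS eD (by
    have h := ((tb.mul (tS.mul l2)).add (tb.mul (tendsto_ofReal_nhdsGT_zero.mul
      ((tS1.const_mul (g : ℂ)).mul l1)))).neg
    simp only [mul_zero, add_zero, neg_zero] at h
    refine h.congr' ?_
    filter_upwards [self_mem_nhdsWithin] with s hs
    have hs0 : (s : ℂ) ≠ 0 := by exact_mod_cast (mem_Ioi.1 hs).ne'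
    rw [cpow_add 1 ((a : ℂ) + g) hs0, cpow_one]
    ring) hs
  have wFS := wronskian_eq (L := -((Gamma (-((a : ℂ) + g)))⁻¹ *
      (c ^ ((a : ℂ) + g) * (Gamma (1 + ((a : ℂ) + g)))⁻¹)))
      (dF (a + g)) (dF (a + g + 1)) dS dS1 eF eS (by
    have h := ((tendsto_ofReal_nhdsGT_zero.mul (tF.mul (tS1.const_mul (g : ℂ)))).sub (tF1.mul tS))
    simp only [zero_mul, zero_sub] at h
    refine h.congr' ?_
    filter_upwards [self_mem_nhdsWithin] with s hs
    obtain ⟨e1, e2⟩ := cpow_mul_kummerFst a (a + g) c hs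
    linear_combination -(g * kummerSnd a (a + g + 1) c s) * e1 + kummerSnd a (a + g) c s * e2) hs
  have hs0 : (s : ℂ) ≠ 0 := by exact_mod_cast hs.ne'
  have hA : (s : ℂ) ^ ((1 : ℂ) + (a + g)) * cexp (-(c * s)) ≠ 0 :=
    mul_ne_zero (cpow_ne_zero_iff_of_exponent_ne_zero (by
      have : (1 : ℝ) + (a + g) ≠ 0 := by linarith
      exact_mod_cast this) |>.2 hs0) (Complex.exp_ne_zero _)
  have w1 := (mul_eq_zero.1 wFD).resolve_left hA
  have w2 := (mul_eq_zero.1 wSD).resolve_left hA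
  have hL : -((Gamma (-((a : ℂ) + g)))⁻¹ *
      (c ^ ((a : ℂ) + g) * (Gamma (1 + ((a : ℂ) + g)))⁻¹)) ≠ 0 := by
    have h1 := Gamma_ofReal_ne_zero (forall_ne_int_neg hint)
    have h2 := Gamma_ofReal_ne_zero (forall_ne_int_add_one hint)
    push_cast at h1 h2
    rw [add_comm] at h2
    have h3 : c ^ ((a : ℂ) + g) ≠ 0 := by
      rw [cpow_def_of_ne_zero hc0]; exact Complex.exp_ne_zero _
    exact neg_ne_zero.2 (mul_ne_zero (inv_ne_zero h1) (mul_ne_zero h3 (inv_ne_zero h2)))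
  rw [← wFS] at hL
  have w3 := right_ne_zero_of_mul hL
  refine sub_eq_zero.1 ((mul_eq_zero.1 ?_).resolve_left w3)
  linear_combination kummerFst a (a + g) c s * (-w2) + kummerSnd a (a + g) c s * w1

/-- Induction downwards in g: the derivative of the difference at g is minus the difference at g +
1, hence 0. For a + g < 0 the limit at s = 0 is the convergent Beta integral on one side. On the
other only `kummerSnd` survives, because s^(−(a+g)) → 0. -/
theorem laplacePow_eq_of_neg_nat_lt (n : ℕ) {a g : ℝ} (hg : 0 < g) (hn : -n < a + g)
    (hag1 : a + g < 1) (hint : ∀ k : ℤ, a + g ≠ k) {c : ℂ} (hc : c ∈ slitPlane) {s : ℝ}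
    (hs : 0 < s) : laplacePow a g c s = kummerLaplace a g c s := by
  induction n generalizing g s with
  | zero => exact laplacePow_eq_of_pos hg (by simpa using hn) hag1 hc hs
  | succ n ih =>
    have h0 : a + g ≠ 0 := by simpa using hint 0
    rcases h0.lt_or_gt with h | h
    swap
    · exact laplacePow_eq_of_pos hg h hag1 hc hs
    push_cast at hn
    have hc0 := slitPlane_ne_zero hc
    refine sub_eq_zero.1 (eq_of_hasDerivAt_zero_of_tendsto (R := s + 1)
      (f := fun s : ℝ => laplacePow a g c s - kummerLaplace a g c s) (fun x hx => ?_) ?_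
      ⟨hs, by linarith⟩)
    · have h1 := ih (g := g + 1) (by linarith) (by linarith) (by linarith)
        (fun k hk => forall_ne_int_add_one hint k (by linarith)) hx.1
      refine (((laplacePow_hasDerivAt a hg hc (s := x) (by simpa using hx.1)).sub
        (kummerLaplace_hasDerivAt a hg hc0 (ofReal_mem_slitPlane.2 hx.1))).comp_ofReal).congr_deriv ?_
      rw [h1, sub_self]
    · have l1 := (tendsto_laplace_nhdsGT (integrableOn_powKernel hg h hc)).1
      have l2 := (tendsto_ofReal_cpow_nhdsGT (p := -((a : ℂ) + g)) (by simp; linarith)).mul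
        (tendsto_regularizedHGFun_nhdsGT (-a) (1 - (a + g)) c)
      have l3 := l1.sub ((l2.sub ((kummerSnd_tendsto a (a + g) c).const_mul
        (Gamma g / Gamma (-a)))).const_mul (Real.pi / Complex.sin (Real.pi * ((a : ℂ) + g))))
      convert l3 using 2
      · rfl
      rw [integral_powKernel hg h hc]
      have hk := Gamma_mul_Gamma_one_sub (-((a : ℂ) + g))
      rw [mul_neg, Complex.sin_neg, div_neg, sub_neg_eq_add] at hk
      have hG := Gamma_ofReal_ne_zero (forall_ne_int_add_one hint)
      push_cast at hG
      rw [show (Real.pi : ℂ) / Complex.sin (Real.pi * ((a : ℂ) + g)) =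
        -(Gamma (-((a : ℂ) + g)) * Gamma (1 + ((a : ℂ) + g))) by rw [hk]; ring]
      rw [add_comm _ (1 : ℂ)] at hG
      field_simp
      ring

/-- The Laplace transform of `(t + c) ^ a * t ^ (g - 1)` in terms of Kummer functions. -/
theorem laplacePow_eq {a g : ℝ} (hg : 0 < g) (hag1 : a + g < 1) (hint : ∀ k : ℤ, a + g ≠ k)
    {c : ℂ} (hc : c ∈ slitPlane) {s : ℂ} (hs : 0 < s.re) :
    laplacePow a g c s = kummerLaplace a g c s := by
  have hopen : IsOpen {s : ℂ | 0 < s.re} := isOpen_lt continuous_const continuous_re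
  obtain ⟨n, hn⟩ := exists_nat_gt (-(a + g))
  have h1 : DifferentiableOn ℂ (laplacePow a g c) {s : ℂ | 0 < s.re} := fun s hs =>
    (laplacePow_hasDerivAt a hg hc hs).differentiableAt.differentiableWithinAt
  have h2 : DifferentiableOn ℂ (kummerLaplace a g c) {s : ℂ | 0 < s.re} := fun s hs =>
    (kummerLaplace_hasDerivAt a hg (slitPlane_ne_zero hc)
      (Or.inl hs)).differentiableAt.differentiableWithinAt
  refine (h1.analyticOnNhd hopen).eqOn_of_preconnected_of_frequently_eq (h2.analyticOnNhd hopen)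
    (convex_halfSpace_re_gt 0).isPreconnected (z₀ := ((1 : ℝ) : ℂ)) (by simp) ?_ hs
  have ht : Tendsto (fun x : ℝ => (x : ℂ)) (𝓝[≠] 1) (𝓝[≠] ((1 : ℝ) : ℂ)) :=
    tendsto_nhdsWithin_of_tendsto_nhds_of_eventually_within _
      ((continuous_ofReal.tendsto 1).mono_left nhdsWithin_le_nhds)
      (by filter_upwards [self_mem_nhdsWithin] with x hx
          simpa using hx)
  refine ht.frequently (Eventually.frequently ?_)
  filter_upwards [mem_nhdsWithin_of_mem_nhds (Ioi_mem_nhds one_pos)] with x hx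
  exact laplacePow_eq_of_neg_nat_lt n hg (by linarith) hag1 hint hc hx

/-- The choice ζ = log c + log s makes e^((a+g)ζ) = c^(a+g) s^(a+g) without any restriction on the
arguments, which the principal logarithm of c s would not do. -/
theorem kummerLaplace_eq_kummerULog {a g : ℝ} (hg : 0 < g) {c s : ℂ}
    (hc : c ≠ 0) (hs : s ≠ 0) {ζ : ℂ} (hζ : ζ = log c + log s) :
    kummerLaplace a g c s =
      Gamma g * s ^ (-((a : ℂ) + g)) * kummerULog (-a) (1 - (a + g)) ζ := by
  have hG : Gamma (g : ℂ) ≠ 0 := Gamma_ne_zero_of_re_pos (by simpa)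
  have h1 : cexp ζ = c * s := by rw [hζ, Complex.exp_add, exp_log hc, exp_log hs]
  have h2 : cexp ((1 - (1 - ((a : ℂ) + g))) * ζ) = c ^ ((a : ℂ) + g) * s ^ ((a : ℂ) + g) := by
    rw [cpow_def_of_ne_zero hc, cpow_def_of_ne_zero hs, ← Complex.exp_add, hζ]
    ring_nf
  have h3 : Complex.sin (Real.pi * (1 - ((a : ℂ) + g))) = Complex.sin (Real.pi * (a + g)) := by
    rw [mul_sub, mul_one, Complex.sin_pi_sub]
  have h4 : s ^ (-((a : ℂ) + g)) * s ^ ((a : ℂ) + g) = 1 := by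
    rw [← cpow_add _ _ hs]; simp
  rw [kummerULog, h1, h2, h3, kummerLaplace, kummerFst, kummerSnd,
    show 1 + -(a : ℂ) - (1 - (a + g)) = g by ring, show 2 - (1 - ((a : ℂ) + g)) = 1 + (a + g) by ring,
    show (a : ℂ) + g - a = g by ring]
  field_simp
  linear_combination (Gamma (g : ℂ) * c ^ ((a : ℂ) + g) *
    regularizedHGFun {(g : ℂ)} {1 + ((a : ℂ) + g)} (c * s) * (Gamma (-(a : ℂ)))⁻¹ *
    (Complex.sin (Real.pi * ((a : ℂ) + g)))⁻¹) * h4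

/-! ### The Stieltjes integral at z = 0. -/

/-- The kernel of the Stieltjes type integral. -/
noncomputable def stieltjesKernel (a g : ℝ) (c : ℂ) (t : ℝ) : ℂ :=
  powKernel a g c t / (1 + t)

theorem one_add_ofReal_ne_zero {t : ℝ} (ht : 0 ≤ t) : (1 : ℂ) + t ≠ 0 := by
  rw [add_comm]; exact add_ne_zero_of_mem_slitPlane one_mem_slitPlane ht

theorem norm_one_add_ofReal {t : ℝ} (ht : 0 ≤ t) : ‖(1 : ℂ) + t‖ = 1 + t := by
  rw [← ofReal_one, ← ofReal_add, norm_real, Real.norm_of_nonneg (by linarith)]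

theorem stieltjesWeight_continuousOn (g : ℝ) :
    ContinuousOn (fun t : ℝ => (t : ℂ) ^ ((g : ℂ) - 1) / (1 + t)) (Ioi 0) :=
  (continuousOn_ofReal_cpow _).div (by fun_prop) fun _ ht => one_add_ofReal_ne_zero (mem_Ioi.1 ht).le

theorem stieltjesWeight_integrableOn {a g : ℝ} (hg : 0 < g) (hag : a + g < 1) :
    IntegrableOn (fun t : ℝ => (1 + t) ^ a * ‖(t : ℂ) ^ ((g : ℂ) - 1) / (1 + t)‖) (Ioi 0) := by
  refine (integrableOn_one_add_rpow_mul_rpow (a := a - 1) hg (by linarith)).congr_fun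
    (fun t ht => ?_) measurableSet_Ioi
  have ht0 : 0 < t := ht
  simp only
  rw [norm_div, norm_one_add_ofReal ht0.le, norm_ofReal_cpow_sub_one g ht0,
    Real.rpow_sub_one (by linarith)]
  ring

theorem stieltjesKernel_eq (a g : ℝ) (c : ℂ) (t : ℝ) :
    stieltjesKernel a g c t = ((t : ℂ) + c) ^ (a : ℂ) * ((t : ℂ) ^ ((g : ℂ) - 1) / (1 + t)) := by
  rw [stieltjesKernel, powKernel, mul_div_assoc]

theorem integrableOn_stieltjesKernel {a g : ℝ} (hg : 0 < g) (hag : a + g < 1) {c : ℂ}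
    (hc : c ∈ slitPlane) : IntegrableOn (stieltjesKernel a g c) (Ioi 0) := by
  refine (integrableOn_add_cpow_mul hc
    ((stieltjesWeight_continuousOn g).aestronglyMeasurable measurableSet_Ioi)
    (stieltjesWeight_integrableOn hg hag)).congr_fun (fun t _ => ?_) measurableSet_Ioi
  rw [stieltjesKernel_eq]

/-- The Stieltjes type integral at `z = 0`. -/
noncomputable def stieltjesPow (a g : ℝ) (c : ℂ) : ℂ :=
  ∫ t in Ioi (0 : ℝ), stieltjesKernel a g c t

theorem stieltjesPow_hasDerivAt {a g : ℝ} (hg : 0 < g) (hag : a + g < 1) {c : ℂ}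
    (hc : c ∈ slitPlane) :
    ∃ d, HasDerivAt (stieltjesPow a g) d c ∧ (1 - c) * d + a * stieltjesPow a g c =
      a * (Gamma g * Gamma (1 - (a + g)) / Gamma (1 - a) * c ^ ((a : ℂ) + g - 1)) := by
  have hd := hasDerivAt_integral_add_cpow hc (a := a)
    ((stieltjesWeight_continuousOn g).aestronglyMeasurable measurableSet_Ioi)
    (stieltjesWeight_integrableOn hg hag)
  refine ⟨_, hd.congr_of_eventuallyEq (Eventually.of_forall fun x => ?_), ?_⟩
  · simp only [stieltjesPow, stieltjesKernel_eq]
  have h1 := integral_powKernel (a := a - 1) hg (by linarith) hc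
  rw [show -(((a - 1 : ℝ) : ℂ) + g) = 1 - (a + g) by push_cast; ring,
    show -((a - 1 : ℝ) : ℂ) = 1 - a by push_cast; ring,
    show ((a - 1 : ℝ) : ℂ) + g = a + g - 1 by push_cast; ring] at h1
  have i1 := integrableOn_stieltjesKernel (a := a - 1) hg (by linarith) hc
  have i2 := integrableOn_stieltjesKernel hg hag hc
  -- Splitting 1 + t = (1 − c) + (t + c) over the denominator 1 + t expresses the Beta integral
  -- through the function and its derivative.
  have h2 : ∫ t in Ioi (0 : ℝ), powKernel (a - 1) g c t =
      (1 - c) * (∫ t in Ioi (0 : ℝ), stieltjesKernel (a - 1) g c t) +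
        ∫ t in Ioi (0 : ℝ), stieltjesKernel a g c t := by
    rw [← integral_const_mul, ← integral_add (i1.const_mul _) i2]
    refine setIntegral_congr_fun measurableSet_Ioi fun t ht => ?_
    have ht0 : 0 ≤ t := (mem_Ioi.1 ht).le
    have e1 := powKernel_add_one_left (a - 1) g hc ht0
    rw [sub_add_cancel] at e1
    have := one_add_ofReal_ne_zero ht0
    simp only [stieltjesKernel]
    rw [e1]
    field_simp
    ring
  simp only [← stieltjesKernel_eq]
  rw [← h1, h2, stieltjesPow]
  ring

theorem ofReal_mul_mem_slitPlane {c : ℂ} (hc : c ∈ slitPlane) {r : ℝ} (hr : 0 < r) :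
    (r : ℂ) * c ∈ slitPlane := by
  rw [mem_slitPlane_iff] at hc ⊢
  rcases hc with h | h
  · left; rw [re_ofReal_mul]; positivity
  · right; rw [im_ofReal_mul]; exact mul_ne_zero hr.ne' h

theorem integral_stieltjesWeight {b : ℝ} (hb : 0 < b) (hb1 : b < 1) :
    ∫ t in Ioi (0 : ℝ), (t : ℂ) ^ ((b : ℂ) - 1) / (1 + t) =
      Real.pi / Complex.sin (Real.pi * b) := by
  have h := integral_powKernel_one (a := -1) hb (by linarith)
  rw [show -(((-1 : ℝ) : ℂ) + b) = 1 - b by push_cast; ring,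
    show -((-1 : ℝ) : ℂ) = 1 by push_cast; ring, Gamma_one, div_one, Gamma_mul_Gamma_one_sub] at h
  rw [← h]
  refine setIntegral_congr_fun measurableSet_Ioi fun t ht => ?_
  simp only [powKernel]
  rw [ofReal_neg, ofReal_one, cpow_neg_one, add_comm (t : ℂ) 1, div_eq_inv_mul]

theorem stieltjesPow_tendsto {a g : ℝ} (hg : 0 < g) (hag : 0 < a + g) (hag1 : a + g < 1) {c : ℂ}
    (hc : c ∈ slitPlane) :
    Tendsto (fun r : ℝ => stieltjesPow a g (r * c)) (𝓝[>] 0)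
      (𝓝 (Real.pi / Complex.sin (Real.pi * (a + g)))) := by
  have h0 := integral_stieltjesWeight hag hag1
  push_cast at h0
  rw [← h0]
  obtain ⟨K, hK, hb⟩ := exists_norm_add_mul_cpow_le hc a
  have hw := (stieltjesWeight_continuousOn g).aestronglyMeasurable (μ := volume) measurableSet_Ioi
  have i1 := stieltjesWeight_integrableOn (a := a) hg hag1
  have i2 := stieltjesWeight_integrableOn (a := 0) hag (by linarith)
  simp only [stieltjesPow, stieltjesKernel_eq]
  refine tendsto_integral_filter_of_dominated_convergence
    (fun t => K * ((1 + t) ^ a * ‖(t : ℂ) ^ ((g : ℂ) - 1) / (1 + t)‖ +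
      (1 + t) ^ (0 : ℝ) * ‖(t : ℂ) ^ (((a + g : ℝ) : ℂ) - 1) / (1 + t)‖)) ?_ ?_
      ((i1.add i2).const_mul K) ?_
  · filter_upwards [self_mem_nhdsWithin] with r hr
    exact (aestronglyMeasurable_add_cpow (ofReal_mul_mem_slitPlane hc hr) _).mul hw
  · filter_upwards [Ioo_mem_nhdsGT one_pos] with r hr
    filter_upwards [ae_restrict_mem measurableSet_Ioi] with t ht
    have ht0 : 0 < t := ht
    -- One of the two summands dominates according to the sign of a, so the sum is a majorant
    -- independent of r in (0, 1).
    have h1 : (r + t) ^ a ≤ (1 + t) ^ a + t ^ a := by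
      have hr0 := hr.1
      rcases le_total 0 a with ha | ha
      · exact (Real.rpow_le_rpow (by linarith) (by linarith [hr.2]) ha).trans
          (le_add_of_nonneg_right (by positivity))
      · exact (Real.rpow_le_rpow_of_nonpos ht0 (by linarith) ha).trans
          (le_add_of_nonneg_left (by positivity))
    have h2 : ‖(t : ℂ) ^ (((a + g : ℝ) : ℂ) - 1) / (1 + t)‖ =
        t ^ a * ‖(t : ℂ) ^ ((g : ℂ) - 1) / (1 + t)‖ := by
      rw [norm_div, norm_div, norm_ofReal_cpow_sub_one _ ht0, norm_ofReal_cpow_sub_one _ ht0,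
        add_sub_assoc, Real.rpow_add ht0, mul_div_assoc]
    rw [norm_mul, h2, Real.rpow_zero, one_mul, ← add_mul, ← mul_assoc]
    refine mul_le_mul_of_nonneg_right ((hb t r ht0.le hr.1).trans ?_) (norm_nonneg _)
    exact mul_le_mul_of_nonneg_left h1 hK.le
  · filter_upwards [ae_restrict_mem measurableSet_Ioi] with t ht
    have ht0 : (t : ℂ) ≠ 0 := by exact_mod_cast (mem_Ioi.1 ht).ne'
    have hcont : ContinuousAt (fun r : ℝ => ((t : ℂ) + r * c) ^ (a : ℂ)) 0 :=
      ContinuousAt.cpow (by fun_prop) continuousAt_const (by simpa using ht)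
    have h1 := (hcont.tendsto.mono_left (nhdsWithin_le_nhds (s := Ioi 0))).mul_const
      ((t : ℂ) ^ ((g : ℂ) - 1) / (1 + t))
    convert h1 using 2
    rw [ofReal_zero, zero_mul, add_zero, show (a : ℂ) + g - 1 = a + (g - 1) by ring,
      cpow_add _ _ ht0, mul_div_assoc]

theorem expCoefficient_add (a g : ℝ) (c : ℂ) :
    expCoefficient a (a + g) c = (Real.pi : ℂ) / Complex.sin (Real.pi * (a + g)) *
    ((1 - c) ^ (a : ℂ) - Gamma g / (Gamma (-a) * Gamma (1 + (a + g))) *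
      ordinaryHypergeometric (1 : ℂ) (g : ℂ) (1 + (a + g)) c * c ^ ((a : ℂ) + g)) := by
  rw [expCoefficient]
  push_cast
  rw [add_sub_cancel_left]

theorem one_sub_mem_slitPlane {c : ℂ} (hc : ‖c‖ < 1) : 1 - c ∈ slitPlane := by
  rw [sub_eq_add_neg]
  exact mem_slitPlane_of_norm_lt_one (by simpa using hc)

/-- This is the equation of `stieltjesPow_hasDerivAt`: (1 − c)^a solves the homogeneous equation,
and the hypergeometric term is a particular solution. -/
theorem expCoefficient_hasDerivAt {a g : ℝ} (hg : 0 < g) (hint : ∀ k : ℤ, a + g ≠ k)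
    {c : ℂ} (hc : c ∈ slitPlane) (hc1 : ‖c‖ < 1) :
    ∃ d, HasDerivAt (expCoefficient a (a + g)) d c ∧ (1 - c) * d + a * expCoefficient a (a + g) c =
      a * (Gamma g * Gamma (1 - (a + g)) / Gamma (1 - a) * c ^ ((a : ℂ) + g - 1)) := by
  have hc0 := slitPlane_ne_zero hc
  have hg0 : ∀ n : ℕ, (g : ℂ) ≠ -n := fun n h => by
    have h1 : g = -n := by exact_mod_cast h
    have : (0 : ℝ) ≤ n := n.cast_nonneg
    linarith
  have hb0 := ofReal_ne_neg_nat hint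
  push_cast at hb0
  have hbne : (a : ℂ) + g ≠ 0 := by simpa using hb0 0
  have hG : Gamma ((a : ℂ) + g) ≠ 0 := by exact_mod_cast Gamma_ofReal_ne_zero hint
  obtain ⟨d, hd, he⟩ := ordinaryHypergeometric_one_hasDerivAt hg0 hb0 hc1
  rw [add_comm _ (1 : ℂ)] at hd he
  have h1 : HasDerivAt (fun x : ℂ => x ^ ((a : ℂ) + g)) _ c := (hasDerivAt_id' c).cpow_const hc
  have h2 : HasDerivAt (fun x : ℂ => (1 - x) ^ (a : ℂ)) _ c :=
    ((hasDerivAt_id' c).const_sub 1).cpow_const (one_sub_mem_slitPlane hc1)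
  have h3 := (h2.sub ((hd.const_mul (Gamma g / (Gamma (-a) * Gamma (1 + (a + g))))).mul
    h1)).const_mul ((Real.pi : ℂ) / Complex.sin (Real.pi * (a + g)))
  refine ⟨_, h3.congr_of_eventuallyEq (Eventually.of_forall fun x => expCoefficient_add a g x), ?_⟩
  have e1 : (1 - c) * (1 - c) ^ ((a : ℂ) - 1) = (1 - c) ^ (a : ℂ) := by
    have := slitPlane_ne_zero (one_sub_mem_slitPlane hc1)
    rw [cpow_sub _ _ this, cpow_one]
    field_simp
  have e2 : c ^ ((a : ℂ) + g) = c ^ ((a : ℂ) + g - 1) * c := by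
    rw [cpow_sub _ _ hc0, cpow_one]
    field_simp
  have e3 := Gamma_inv_step (-a)
  rw [show -(a : ℂ) + 1 = 1 - a by ring] at e3
  rw [expCoefficient_add, ← Gamma_mul_Gamma_one_sub, add_comm (1 : ℂ) (a + g),
    Gamma_add_one _ hbne, e2, div_eq_mul_inv _ (Gamma (-(a : ℂ)) * _), mul_inv (Gamma (-(a : ℂ))),
    e3]
  rw [add_comm (1 : ℂ) (a + g)] at he
  generalize ordinaryHypergeometric (1 : ℂ) (g : ℂ) ((a : ℂ) + g + 1) c = F at he ⊢
  generalize c ^ ((a : ℂ) + g - 1) = C at *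
  generalize (1 - c) ^ ((a : ℂ) - 1) = E at *
  rw [← e1, div_eq_mul_inv _ (Gamma (1 - (a : ℂ)))]
  generalize (Gamma (1 - (a : ℂ)))⁻¹ = G at *
  field_simp
  linear_combination a * G * C * Gamma (g : ℂ) * Gamma (1 - ((a : ℂ) + g)) * he

theorem stieltjesPow_eq_of_pos {a g : ℝ} (hg : 0 < g) (hag : 0 < a + g) (hag1 : a + g < 1) {c : ℂ}
    (hc : c ∈ slitPlane) (hc1 : ‖c‖ < 1) : stieltjesPow a g c = expCoefficient a (a + g) c := by
  have hint : ∀ n : ℤ, a + g ≠ n := by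
    rintro n hn
    rw [hn] at hag hag1
    norm_cast at hag hag1
    omega
  have hpos : 0 < ‖c‖ := norm_pos_iff.2 (slitPlane_ne_zero hc)
  -- The two sides are compared along the ray r c, which stays in the cut plane. Dividing their
  -- difference by the homogeneous solution (1 − r c)^a leaves a constant. The bound 1/‖c‖ > 1 keeps
  -- r = 1 in the interior.
  have hd : ∀ r ∈ Ioo 0 (1 / ‖c‖), HasDerivAt (fun r : ℝ =>
      (stieltjesPow a g (r * c) - expCoefficient a (a + g) (r * c)) * (1 - r * c) ^ (-(a : ℂ)))
      0 r := by
    intro r hr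
    have m1 := ofReal_mul_mem_slitPlane hc hr.1
    have m2 : ‖(r : ℂ) * c‖ < 1 := by
      rw [norm_mul, norm_real, Real.norm_of_nonneg hr.1.le]
      exact (lt_div_iff₀ hpos).1 hr.2
    obtain ⟨d1, hd1, e1⟩ := stieltjesPow_hasDerivAt hg hag1 m1
    obtain ⟨d2, hd2, e2⟩ := expCoefficient_hasDerivAt hg hint m1 m2
    have h1 : HasDerivAt (fun x : ℂ => (1 - x) ^ (-(a : ℂ))) _ (r * c) :=
      ((hasDerivAt_id' ((r : ℂ) * c)).const_sub 1).cpow_const (one_sub_mem_slitPlane m2)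
    have h2 : HasDerivAt (fun x : ℂ => x * c) c (r : ℂ) := by
      simpa using (hasDerivAt_id' (r : ℂ)).mul_const c
    refine ((((hd1.sub hd2).mul h1).comp (r : ℂ) h2).comp_ofReal).congr_deriv ?_
    have hne := slitPlane_ne_zero (one_sub_mem_slitPlane m2)
    simp only [Pi.sub_apply]
    rw [cpow_sub _ _ hne, cpow_one]
    field_simp
    linear_combination c * (1 - r * c) ^ (-(a : ℂ)) * (e1 - e2)
  have l1 := stieltjesPow_tendsto hg hag hag1 hc
  have lc : Tendsto (fun r : ℝ => (r : ℂ) * c) (𝓝[>] 0) (𝓝 0) := by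
    simpa using tendsto_ofReal_nhdsGT_zero.mul_const c
  have lpow : ∀ p : ℂ, Tendsto (fun r : ℝ => (1 - r * c) ^ p) (𝓝[>] 0) (𝓝 1) := fun p => by
    have h1 : ContinuousAt (fun x : ℂ => (1 - x) ^ p) 0 :=
      ContinuousAt.cpow (by fun_prop) continuousAt_const (by simp)
    have h2 := h1.tendsto.comp lc
    simpa [Function.comp_def] using h2
  have lF : Tendsto (fun r : ℝ => ordinaryHypergeometric (1 : ℂ) (g : ℂ) (1 + (a + g)) (r * c))
      (𝓝[>] 0) (𝓝 1) := by
    have hg0 : ∀ n : ℕ, (g : ℂ) ≠ -n := fun n h => by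
      have h1 : g = -n := by exact_mod_cast h
      have : (0 : ℝ) ≤ n := n.cast_nonneg
      linarith
    have hb0 := ofReal_ne_neg_nat hint
    push_cast at hb0
    obtain ⟨d, hd, -⟩ := ordinaryHypergeometric_one_hasDerivAt hg0 hb0 (c := 0) (by simp)
    have h2 := hd.continuousAt.tendsto.comp lc
    rw [add_comm _ (1 : ℂ)] at h2
    simpa [Function.comp_def] using h2
  have lC : Tendsto (fun r : ℝ => ((r : ℂ) * c) ^ ((a : ℂ) + g)) (𝓝[>] 0) (𝓝 0) := by
    have hne : (a : ℂ) + g ≠ 0 := by exact_mod_cast hag.ne'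
    have h1 : Tendsto (fun r : ℝ => ((r : ℂ) * c) ^ ((a : ℂ) + g)) (𝓝[>] 0)
        (𝓝 ((0 : ℂ) ^ ((a : ℂ) + g))) :=
      (continuousAt_cpow_zero_of_re_pos (z := (a : ℂ) + g) (by simpa using hag)).tendsto.comp
        (lc.prodMk_nhds tendsto_const_nhds)
    rwa [zero_cpow hne] at h1
  have l2 := (((lpow a).sub ((lF.const_mul (Gamma g / (Gamma (-a) * Gamma (1 + (a + g))))).mul
    lC)).const_mul ((Real.pi : ℂ) / Complex.sin (Real.pi * (a + g))))
  have l3 := (l1.sub l2).mul (lpow (-(a : ℂ)))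
  rw [mul_one, mul_zero, sub_zero, mul_one, sub_self] at l3
  simp only [← expCoefficient_add] at l3
  have h := eq_of_hasDerivAt_zero_of_tendsto hd l3 (s := 1) ⟨one_pos, by rwa [lt_div_iff₀ hpos, one_mul]⟩
  rw [ofReal_one, one_mul] at h
  refine sub_eq_zero.1 ((mul_eq_zero.1 h).resolve_right ?_)
  rw [cpow_def_of_ne_zero (slitPlane_ne_zero (one_sub_mem_slitPlane hc1))]
  exact Complex.exp_ne_zero _

theorem stieltjesPow_eq {a g : ℝ} (hg : 0 < g) (hag1 : a + g < 1) (hint : ∀ k : ℤ, a + g ≠ k)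
    {c : ℂ} (hc : c ∈ slitPlane) (hc1 : ‖c‖ < 1) :
    stieltjesPow a g c = expCoefficient a (a + g) c := by
  obtain ⟨n, hn⟩ := exists_nat_gt (-(a + g))
  induction n generalizing g with
  | zero =>
    rw [Nat.cast_zero] at hn
    exact stieltjesPow_eq_of_pos hg (by linarith) hag1 hc hc1
  | succ n ih =>
    have h0 : a + g ≠ 0 := by simpa using hint 0
    rcases h0.lt_or_gt with h | h
    swap
    · exact stieltjesPow_eq_of_pos hg h hag1 hc hc1
    push_cast at hn
    have h1 := ih (g := g + 1) (by linarith) (by linarith)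
      (fun k hk => forall_ne_int_add_one hint k (by linarith)) (by linarith)
    have i1 := integrableOn_powKernel hg h hc
    have i2 := integrableOn_stieltjesKernel (a := a) (g := g + 1) (by linarith) (by linarith) hc
    -- Here 1/(1 + t) = 1 − t/(1 + t), and the factor t raises g. The remaining integral converges
    -- since a + g < 0.
    have h2 : stieltjesPow a g c =
        (∫ t in Ioi (0 : ℝ), powKernel a g c t) - stieltjesPow a (g + 1) c := by
      rw [stieltjesPow, stieltjesPow, ← integral_sub i1 i2]
      refine setIntegral_congr_fun measurableSet_Ioi fun t ht => ?_
      have := one_add_ofReal_ne_zero (mem_Ioi.1 ht).le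
      simp only [stieltjesKernel]
      rw [powKernel_add_one_right a g c ht]
      field_simp
      ring
    have hg0 : ∀ n : ℕ, (g : ℂ) ≠ -n := fun n h => by
      have h1 : g = -n := by exact_mod_cast h
      have : (0 : ℝ) ≤ n := n.cast_nonneg
      linarith
    have hgne : (g : ℂ) ≠ 0 := by simpa using hg0 0
    have hb1 := ofReal_ne_neg_nat (forall_ne_int_add_one hint)
    have hG := Gamma_ofReal_ne_zero (forall_ne_int_add_one hint)
    push_cast at hb1 hG
    rw [add_comm _ (1 : ℂ)] at hb1 hG
    have hbne : (1 : ℂ) + (a + g) ≠ 0 := by simpa using hb1 0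
    have h3 := ordinaryHypergeometric_one_step hg0 hb1 hc1
    have hk := Gamma_mul_Gamma_one_sub (-((a : ℂ) + g))
    rw [mul_neg, Complex.sin_neg, div_neg, sub_neg_eq_add] at hk
    rw [h2, h1, integral_powKernel hg h hc, ← add_assoc, show a + g + 1 = a + (g + 1) by ring,
      expCoefficient_add, expCoefficient_add, h3,
      show (a : ℂ) + (g + 1 : ℝ) = a + g + 1 by push_cast; ring, sin_pi_mul_add_one, div_neg,
      show (Real.pi : ℂ) / Complex.sin (Real.pi * ((a : ℂ) + g)) =
        -(Gamma (-((a : ℂ) + g)) * Gamma (1 + ((a : ℂ) + g))) by rw [hk]; ring, ofReal_add,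
      ofReal_one, Gamma_add_one _ hgne, show (1 : ℂ) + (a + g + 1) = 1 + (a + g) + 1 by ring,
      Gamma_add_one _ hbne, cpow_add _ 1 (slitPlane_ne_zero hc), cpow_one]
    field_simp
    ring

/-! ### The Laplace transform of the Stieltjes kernel, by integration along the segment from 0 to z.
-/

/-- The Laplace transform of the Stieltjes kernel. -/
noncomputable def stieltjesLaplace (a g : ℝ) (c z : ℂ) : ℂ :=
  ∫ t in Ioi (0 : ℝ), stieltjesKernel a g c t * cexp (-z * t)

theorem norm_exp_neg_mul_le_one {z : ℂ} (hz : 0 ≤ z.re) {t : ℝ} (ht : 0 ≤ t) :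
    ‖cexp (-z * t)‖ ≤ 1 := by
  rw [norm_exp_neg_mul]
  exact Real.exp_le_one_iff.2 (neg_nonpos.2 (mul_nonneg hz ht))

theorem integrableOn_stieltjesKernel_mul_exp {a g : ℝ} (hg : 0 < g) (hag : a + g < 1) {c : ℂ}
    (hc : c ∈ slitPlane) {z : ℂ} (hz : 0 ≤ z.re) :
    IntegrableOn (fun t : ℝ => stieltjesKernel a g c t * cexp (-z * t)) (Ioi 0) := by
  have h := integrableOn_stieltjesKernel hg hag hc
  refine Integrable.mono' h.norm (h.aestronglyMeasurable.mul
    (aestronglyMeasurable_exp_neg_mul z _)) ?_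
  filter_upwards [ae_restrict_mem measurableSet_Ioi] with t ht
  rw [norm_mul]
  exact mul_le_of_le_one_right (norm_nonneg _) (norm_exp_neg_mul_le_one hz (mem_Ioi.1 ht).le)

theorem stieltjesLaplace_continuousOn {a g : ℝ} (hg : 0 < g) (hag : a + g < 1) {c : ℂ}
    (hc : c ∈ slitPlane) : ContinuousOn (stieltjesLaplace a g c) {z : ℂ | 0 ≤ z.re} := by
  have h := integrableOn_stieltjesKernel hg hag hc
  refine continuousOn_of_dominated (bound := fun t => ‖stieltjesKernel a g c t‖) (fun z _ =>
    h.aestronglyMeasurable.mul (aestronglyMeasurable_exp_neg_mul z _)) (fun z hz => ?_) h.norm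
    (Eventually.of_forall fun t => by fun_prop)
  filter_upwards [ae_restrict_mem measurableSet_Ioi] with t ht
  rw [norm_mul]
  exact mul_le_of_le_one_right (norm_nonneg _) (norm_exp_neg_mul_le_one hz (mem_Ioi.1 ht).le)

theorem exp_neg_mul_stieltjesLaplace_hasDerivAt {a g : ℝ} (hg : 0 < g) (hag : a + g < 1) {c : ℂ}
    (hc : c ∈ slitPlane) {s : ℂ} (hs : 0 < s.re) :
    HasDerivAt (fun s => cexp (-s) * stieltjesLaplace a g c s)
      (-(cexp (-s) * laplacePow a g c s)) s := by
  have h := integrableOn_stieltjesKernel hg hag hc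
  have hL : LaplaceIntegrable (stieltjesKernel a g c) :=
    LaplaceIntegrable.of_norm_le (p := 0) h.aestronglyMeasurable h.norm fun t _ => by simp
  have i1 := (laplaceIntegrable_powKernel a hg hc).integrableOn hs
  have i2 := hL.integrableOn hs
  have h1 : ∫ t in Ioi (0 : ℝ), t * stieltjesKernel a g c t * cexp (-s * t) =
      laplacePow a g c s - stieltjesLaplace a g c s := by
    rw [laplacePow, stieltjesLaplace, ← integral_sub i1 i2]
    refine setIntegral_congr_fun measurableSet_Ioi fun t ht => ?_
    have := one_add_ofReal_ne_zero (mem_Ioi.1 ht).le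
    simp only [stieltjesKernel]
    field_simp
    ring
  have h2 := hL.hasDerivAt hs
  rw [h1] at h2
  have h3 : HasDerivAt (fun s : ℂ => cexp (-s)) (cexp (-s) * -1) s := (hasDerivAt_id' s).fun_neg.cexp
  refine (h3.mul h2).congr_deriv ?_
  simp only [stieltjesLaplace]
  ring

theorem ofReal_mul_cpow {r : ℝ} (hr : 0 < r) {z : ℂ} (hz : z ≠ 0) (p : ℂ) :
    ((r : ℂ) * z) ^ p = (r : ℂ) ^ p * z ^ p := by
  have hr0 : (r : ℂ) ≠ 0 := by exact_mod_cast hr.ne'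
  rw [cpow_def_of_ne_zero (mul_ne_zero hr0 hz), cpow_def_of_ne_zero hr0, cpow_def_of_ne_zero hz,
    log_ofReal_mul hr hz, ofReal_log hr.le, ← Complex.exp_add]
  ring_nf

theorem intervalIntegrable_one_sub_cpow {p : ℂ} (hp : p.re < 1) :
    IntervalIntegrable (fun t : ℝ => ((1 - t : ℝ) : ℂ) ^ (-p)) volume 0 1 := by
  have h := (intervalIntegral.intervalIntegrable_cpow' (r := -p) (a := 1) (b := 0)
    (by simpa using hp)).comp_sub_left 1
  simpa using h

theorem continuous_integral_mul {w : ℝ → ℂ} (hw : IntervalIntegrable w volume 0 1)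
    {F : ℂ → ℝ → ℂ} (hF : Continuous (Function.uncurry F)) :
    Continuous fun z => ∫ t in (0 : ℝ)..1, w t * F z t := by
  rw [continuous_iff_continuousAt]
  intro z
  obtain ⟨C, hC⟩ := ((isCompact_closedBall z 1).prod (isCompact_Icc (a := (0 : ℝ)) (b := 1))).exists_bound_of_continuousOn
    hF.continuousOn
  refine intervalIntegral.continuousAt_of_dominated_interval (bound := fun t => ‖w t‖ * C) ?_ ?_
    (hw.norm.mul_const C) ?_
  · refine Eventually.of_forall fun x => hw.def'.aestronglyMeasurable.mul ?_
    exact (hF.comp (Continuous.prodMk_right x)).aestronglyMeasurable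
  · filter_upwards [Metric.closedBall_mem_nhds z one_pos] with x hx
    refine Eventually.of_forall fun t ht => ?_
    rw [uIoc_of_le zero_le_one] at ht
    rw [norm_mul]
    exact mul_le_mul_of_nonneg_left (hC (x, t) ⟨hx, ht.1.le, ht.2⟩) (norm_nonneg _)
  · refine Eventually.of_forall fun t _ => ?_
    exact (continuous_const.mul (hF.comp (Continuous.prodMk_left t))).continuousAt

theorem continuous_regularizedHGFun (a b : ℂ) : Continuous (regularizedHGFun {a} {b}) :=
  continuous_iff_continuousAt.2 fun w => (regularizedHGFun_hasDerivAt a b w).continuousAt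

/-- The function `exp (z t) ₁F₁(a; b; c z (1 - t)) / Γ(b)`. -/
noncomputable def expHG (a b c z : ℂ) (t : ℝ) : ℂ :=
  cexp (z * t) * regularizedHGFun {a} {b} (c * (((1 - t : ℝ) : ℂ) * z))

theorem continuous_uncurry_expHG (a b c : ℂ) : Continuous (Function.uncurry (expHG a b c)) := by
  have h := continuous_regularizedHGFun a b
  unfold expHG Function.uncurry
  fun_prop

theorem continuous_expHG (a b c z : ℂ) : Continuous (expHG a b c z) :=
  (continuous_uncurry_expHG a b c).comp (Continuous.prodMk_right z)

/-- The integral `∫₀¹ exp (z t) f((1 - t) z) dt` with `f = kummerLaplace a g c`. -/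
noncomputable def kummerIntegral (a g : ℝ) (c z : ℂ) : ℂ :=
  ∫ t in (0 : ℝ)..1, cexp (z * t) * kummerLaplace a g c (((1 - t : ℝ) : ℂ) * z)

theorem exp_mul_kummerLaplace (a g : ℝ) (c : ℂ) {z : ℂ} (hz : z ≠ 0) {t : ℝ} (ht : t < 1) :
    cexp (z * t) * kummerLaplace a g c (((1 - t : ℝ) : ℂ) * z) =
      Real.pi / Complex.sin (Real.pi * (a + g)) * (z ^ (-((a : ℂ) + g)) *
        (((1 - t : ℝ) : ℂ) ^ (-((a : ℂ) + g)) * expHG (-a) (1 - (a + g)) c z t) -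
        Gamma g / Gamma (-a) * c ^ ((a : ℂ) + g) * (1 * expHG (a + g - a) (1 + (a + g)) c z t)) := by
  rw [kummerLaplace, kummerFst, kummerSnd, ofReal_mul_cpow (by linarith) hz, expHG, expHG]
  ring

/-- The only singular factor in t is (1 − t)^(−(a+g)), integrable as a + g < 1 and free of z. The
split form exhibits the integral as a continuous function of z on the slit plane, as needed to reach
the imaginary axis. -/
theorem intervalIntegrable_exp_mul_kummerLaplace {a g : ℝ} (hag : a + g < 1) (c : ℂ) {z : ℂ}
    (hz : z ≠ 0) : IntervalIntegrable
      (fun t : ℝ => cexp (z * t) * kummerLaplace a g c (((1 - t : ℝ) : ℂ) * z)) volume 0 1 ∧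
    kummerIntegral a g c z = Real.pi / Complex.sin (Real.pi * (a + g)) * (z ^ (-((a : ℂ) + g)) *
        (∫ t in (0 : ℝ)..1, ((1 - t : ℝ) : ℂ) ^ (-((a : ℂ) + g)) *
          expHG (-a) (1 - (a + g)) c z t) - Gamma g / Gamma (-a) * c ^ ((a : ℂ) + g) *
        ∫ t in (0 : ℝ)..1, 1 * expHG (a + g - a) (1 + (a + g)) c z t) := by
  have h1 := (intervalIntegrable_one_sub_cpow (p := (a : ℂ) + g) (by simpa using hag)).mul_continuousOn
    (continuous_expHG (-a) (1 - (a + g)) c z).continuousOn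
  have h2 : IntervalIntegrable (fun t : ℝ => 1 * expHG (a + g - a) (1 + (a + g)) c z t) volume 0 1 :=
    (continuous_const.mul (continuous_expHG _ _ c z)).intervalIntegrable _ _
  have he : ∀ᵐ t : ℝ, t ∈ uIoc (0 : ℝ) 1 →
      cexp (z * t) * kummerLaplace a g c (((1 - t : ℝ) : ℂ) * z) =
      Real.pi / Complex.sin (Real.pi * (a + g)) * (z ^ (-((a : ℂ) + g)) *
        (((1 - t : ℝ) : ℂ) ^ (-((a : ℂ) + g)) * expHG (-a) (1 - (a + g)) c z t) -
        Gamma g / Gamma (-a) * c ^ ((a : ℂ) + g) *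
          (1 * expHG (a + g - a) (1 + (a + g)) c z t)) := by
    have h0 : ∀ᵐ t : ℝ, t ≠ 1 := by simp [ae_iff]
    filter_upwards [h0] with t h0 ht
    rw [uIoc_of_le zero_le_one] at ht
    exact exp_mul_kummerLaplace a g c hz (lt_of_le_of_ne ht.2 h0)
  have h3 := ((h1.const_mul (z ^ (-((a : ℂ) + g)))).sub
    (h2.const_mul (Gamma g / Gamma (-a) * c ^ ((a : ℂ) + g)))).const_mul
      (Real.pi / Complex.sin (Real.pi * ((a : ℂ) + g)))
  constructor
  · refine h3.congr_ae ?_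
    rw [Filter.EventuallyEq, ae_restrict_iff' measurableSet_uIoc]
    filter_upwards [he] with t ht h
    exact (ht h).symm
  · rw [kummerIntegral, intervalIntegral.integral_congr_ae he, intervalIntegral.integral_const_mul,
      intervalIntegral.integral_sub (h1.const_mul _) (h2.const_mul _),
      intervalIntegral.integral_const_mul, intervalIntegral.integral_const_mul]

/-- The fundamental theorem of calculus is applied to e^(−rz) S(rz) on [0, 1], with continuity alone
at r = 0, where the Laplace transform of the power kernel need not converge. The substitution r = 1
− t and a factor e^z give the stated form. -/
theorem stieltjesLaplace_eq_of_re_pos {a g : ℝ} (hg : 0 < g) (hag1 : a + g < 1)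
    (hint : ∀ k : ℤ, a + g ≠ k) {c : ℂ} (hc : c ∈ slitPlane) (hc1 : ‖c‖ < 1) {z : ℂ}
    (hz : 0 < z.re) : stieltjesLaplace a g c z =
      expCoefficient a (a + g) c * cexp z - z * kummerIntegral a g c z := by
  have hz0 : z ≠ 0 := by rintro rfl; simp at hz
  have hre : ∀ r : ℝ, ((r : ℂ) * z).re = r * z.re := fun r => re_ofReal_mul _ _
  have hcont : ContinuousOn (fun r : ℝ => cexp (-(r * z)) * stieltjesLaplace a g c (r * z))
      (Icc 0 1) := by
    refine ContinuousOn.mul (by fun_prop) ?_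
    refine (stieltjesLaplace_continuousOn hg hag1 hc).comp (by fun_prop) fun r hr => ?_
    change 0 ≤ ((r : ℂ) * z).re
    rw [hre]
    exact mul_nonneg hr.1 hz.le
  have hd : ∀ r ∈ Ioo (0 : ℝ) 1, HasDerivAt
      (fun r : ℝ => cexp (-(r * z)) * stieltjesLaplace a g c (r * z))
      (-z * (cexp (-(r * z)) * kummerLaplace a g c (r * z))) r := by
    intro r hr
    have hpos : 0 < ((r : ℂ) * z).re := by rw [hre]; exact mul_pos hr.1 hz
    have h2 : HasDerivAt (fun x : ℂ => x * z) z (r : ℂ) := by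
      simpa using (hasDerivAt_id' (r : ℂ)).mul_const z
    refine (((exp_neg_mul_stieltjesLaplace_hasDerivAt hg hag1 hc hpos).comp (r : ℂ)
      h2).comp_ofReal).congr_deriv ?_
    rw [laplacePow_eq hg hag1 hint hc hpos]
    ring
  obtain ⟨i1, -⟩ := intervalIntegrable_exp_mul_kummerLaplace (a := a) (g := g) hag1 c hz0
  have hexp : ∀ t : ℝ, cexp (-((1 - t : ℝ) * z)) = cexp (-z) * cexp (z * t) := fun t => by
    rw [← Complex.exp_add]; push_cast; ring_nf
  have i2 : IntervalIntegrable (fun r : ℝ => -z * (cexp (-(r * z)) * kummerLaplace a g c (r * z)))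
      volume 0 1 := by
    have h := ((i1.const_mul (-z * cexp (-z))).comp_sub_left 1).symm
    simp only [sub_zero, sub_self] at h
    refine h.congr fun t _ => ?_
    have h1 := hexp (1 - t)
    rw [sub_sub_cancel] at h1
    rw [sub_sub_cancel, h1]
    ring
  have h := intervalIntegral.integral_eq_sub_of_hasDerivAt_of_le zero_le_one hcont hd i2
  have h1 := intervalIntegral.integral_comp_sub_left (a := 0) (b := 1)
    (fun r : ℝ => -z * (cexp (-(r * z)) * kummerLaplace a g c (r * z))) 1
  simp only [sub_zero, sub_self, hexp] at h1
  have h2 : stieltjesLaplace a g c 0 = expCoefficient a (a + g) c := by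
    rw [← stieltjesPow_eq hg hag1 hint hc hc1]
    simp [stieltjesLaplace, stieltjesPow]
  rw [← h1] at h
  simp only [mul_assoc] at h
  rw [intervalIntegral.integral_const_mul, intervalIntegral.integral_const_mul] at h
  simp only [ofReal_one, one_mul, ofReal_zero, zero_mul, neg_zero, Complex.exp_zero, h2] at h
  have h3 : cexp z * cexp (-z) = 1 := by rw [← Complex.exp_add]; simp
  rw [kummerIntegral]
  linear_combination (-cexp z) * h + (-stieltjesLaplace a g c z - z * ∫ t in (0 : ℝ)..1,
    cexp (z * t) * kummerLaplace a g c (((1 - t : ℝ) : ℂ) * z)) * h3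

theorem mem_slitPlane_of_re_nonneg {z : ℂ} (hz : 0 ≤ z.re) (hz0 : z ≠ 0) : z ∈ slitPlane := by
  rw [mem_slitPlane_iff]
  by_contra! h
  exact hz0 (Complex.ext (le_antisymm h.1 hz) h.2)

theorem stieltjesLaplace_eq {a g : ℝ} (hg : 0 < g) (hag1 : a + g < 1)
    (hint : ∀ k : ℤ, a + g ≠ k) {c : ℂ} (hc : c ∈ slitPlane) (hc1 : ‖c‖ < 1) {z : ℂ}
    (hz : 0 ≤ z.re) : stieltjesLaplace a g c z =
      expCoefficient a (a + g) c * cexp z - z * kummerIntegral a g c z := by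
  by_cases hz0 : z = 0
  · rw [hz0, zero_mul, sub_zero, Complex.exp_zero, mul_one, ← stieltjesPow_eq hg hag1 hint hc hc1]
    simp [stieltjesLaplace, stieltjesPow]
  -- Points of the imaginary axis other than 0 are approached from the right: both sides are
  -- continuous there, and z lies in the slit plane.
  have lz : Tendsto (fun ε : ℝ => z + ε) (𝓝[>] 0) (𝓝 z) := by
    simpa using tendsto_ofReal_nhdsGT_zero.const_add z
  have hre : ∀ ε : ℝ, 0 < ε → 0 < (z + ε).re := fun ε hε => by
    rw [add_re, ofReal_re]; linarith
  have l1 : Tendsto (fun ε : ℝ => stieltjesLaplace a g c (z + ε)) (𝓝[>] 0)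
      (𝓝 (stieltjesLaplace a g c z)) := by
    refine ((stieltjesLaplace_continuousOn hg hag1 hc) z hz).tendsto.comp ?_
    refine tendsto_nhdsWithin_of_tendsto_nhds_of_eventually_within _ lz ?_
    filter_upwards [self_mem_nhdsWithin] with ε hε using (hre ε hε).le
  have c1 := continuous_integral_mul (intervalIntegrable_one_sub_cpow (p := (a : ℂ) + g)
    (by simpa using hag1)) (continuous_uncurry_expHG (-a) (1 - (a + g)) c)
  have c2 := continuous_integral_mul (w := fun _ => 1) (by simp)
    (continuous_uncurry_expHG (a + g - a) (1 + (a + g)) c)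
  have c3 : ContinuousAt (fun z : ℂ => z ^ (-((a : ℂ) + g))) z :=
    ContinuousAt.cpow continuousAt_id continuousAt_const (mem_slitPlane_of_re_nonneg hz hz0)
  have c4 := ((c3.mul c1.continuousAt).sub (c2.continuousAt.const_mul
    (Gamma g / Gamma (-a) * c ^ ((a : ℂ) + g)))).const_mul
      (Real.pi / Complex.sin (Real.pi * ((a : ℂ) + g)))
  have c5 := (Complex.continuous_exp.continuousAt.const_mul (expCoefficient a (a + g) c)).sub
    ((continuousAt_id (x := z)).mul c4)
  have l2 := c5.tendsto.comp lz
  rw [(intervalIntegrable_exp_mul_kummerLaplace (a := a) (g := g) hag1 c hz0).2]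
  refine tendsto_nhds_unique (l1.congr' ?_) l2
  filter_upwards [self_mem_nhdsWithin] with ε hε
  have hne : z + ε ≠ 0 := fun h => by have := hre ε hε; rw [h] at this; simp at this
  rw [stieltjesLaplace_eq_of_re_pos hg hag1 hint hc hc1 (hre ε hε),
    (intervalIntegrable_exp_mul_kummerLaplace (a := a) (g := g) hag1 c hne).2]
  rfl

/-! ### Passage to Tricomi's function and the theorem. -/

theorem exp_mul_kummerULog {a b : ℝ} (hab : a < b) {c z : ℂ} (hc : c ≠ 0) (hz : z ≠ 0) {t : ℝ}
    (ht : t < 1) :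
    cexp (z * t) * kummerULog (-a) (1 - b) (log c + log z + (Real.log (1 - t) : ℝ)) *
      ((1 - t : ℝ) : ℂ) ^ (-b : ℂ) =
    (Gamma (b - a) * z ^ (-b : ℂ))⁻¹ *
      (cexp (z * t) * kummerLaplace a (b - a) c (((1 - t : ℝ) : ℂ) * z)) := by
  have ht0 : 0 < 1 - t := by linarith
  have hs : ((1 - t : ℝ) : ℂ) * z ≠ 0 := mul_ne_zero (by exact_mod_cast ht0.ne') hz
  have h := kummerLaplace_eq_kummerULog (a := a) (g := b - a) (by linarith) hc hs
    (ζ := log c + log z + (Real.log (1 - t) : ℝ)) (by rw [log_ofReal_mul ht0 hz]; ring)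
  have hG : Gamma ((b : ℂ) - a) ≠ 0 :=
    Gamma_ne_zero_of_re_pos (by rw [sub_re, ofReal_re, ofReal_re]; linarith)
  have hzb : z ^ (-b : ℂ) ≠ 0 := by
    rw [cpow_def_of_ne_zero hz]; exact Complex.exp_ne_zero _
  push_cast at h
  rw [add_sub_cancel] at h
  push_cast
  rw [h]
  have h1 := ofReal_mul_cpow ht0 hz (-b : ℂ)
  push_cast at h1
  rw [h1]
  field_simp

theorem integral_exp_mul_kummerULog {a b : ℝ} (hab : a < b) (hb : b < 1) {c z : ℂ} (hc : c ≠ 0)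
    (hz : z ≠ 0) :
    IntervalIntegrable (fun t : ℝ => cexp (z * t) *
      kummerULog (-a) (1 - b) (log c + log z + (Real.log (1 - t) : ℝ)) *
        ((1 - t : ℝ) : ℂ) ^ (-b : ℂ)) volume 0 1 ∧
    Gamma (b - a) * z ^ (1 - b : ℂ) * (∫ t in (0 : ℝ)..1, cexp (z * t) *
      kummerULog (-a) (1 - b) (log c + log z + (Real.log (1 - t) : ℝ)) *
        ((1 - t : ℝ) : ℂ) ^ (-b : ℂ)) = z * kummerIntegral a (b - a) c z := by
  have he : ∀ᵐ t : ℝ, t ∈ uIoc (0 : ℝ) 1 → cexp (z * t) *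
      kummerULog (-a) (1 - b) (log c + log z + (Real.log (1 - t) : ℝ)) *
        ((1 - t : ℝ) : ℂ) ^ (-b : ℂ) = (Gamma (b - a) * z ^ (-b : ℂ))⁻¹ *
      (cexp (z * t) * kummerLaplace a (b - a) c (((1 - t : ℝ) : ℂ) * z)) := by
    -- The endpoint t = 1 has to be discarded: `Real.log 0` is 0 by convention, so the logarithm of
    -- the argument of U is meaningless there.
    have h0 : ∀ᵐ t : ℝ, t ≠ 1 := by simp [ae_iff]
    filter_upwards [h0] with t h0 ht
    rw [uIoc_of_le zero_le_one] at ht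
    exact exp_mul_kummerULog hab hc hz (lt_of_le_of_ne ht.2 h0)
  obtain ⟨i1, -⟩ := intervalIntegrable_exp_mul_kummerLaplace (a := a) (g := b - a) (by linarith) c hz
  constructor
  · refine (i1.const_mul (Gamma (b - a) * z ^ (-b : ℂ))⁻¹).congr_ae ?_
    rw [Filter.EventuallyEq, ae_restrict_iff' measurableSet_uIoc]
    filter_upwards [he] with t ht h
    exact (ht h).symm
  · have hG : Gamma ((b : ℂ) - a) ≠ 0 :=
      Gamma_ne_zero_of_re_pos (by rw [sub_re, ofReal_re, ofReal_re]; linarith)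
    have hzb : z ^ (-b : ℂ) ≠ 0 := by
      rw [cpow_def_of_ne_zero hz]; exact Complex.exp_ne_zero _
    rw [intervalIntegral.integral_congr_ae he, intervalIntegral.integral_const_mul,
      ← kummerIntegral, show (1 - b : ℂ) = -b + 1 by ring, cpow_add _ _ hz, cpow_one]
    field_simp

theorem mainTheorem5 (α β : ℝ) (c z : ℂ) (hαβ : α < β) (hβ : β < 1)
    (hβ_int : ∀ n : ℤ, β ≠ n)
    (hc_pos : 0 < ‖c‖) (hc_lt : ‖c‖ < 1) (hc_arg : |Complex.arg c| < Real.pi)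
    (hz : 0 ≤ z.re) :
    -- the integral on the left converges absolutely
    IntegrableOn (fun t : ℝ => ((t : ℂ) + c) ^ (α : ℂ) * (t : ℂ) ^ ((β : ℂ) - α - 1) / (1 + t) *
        Complex.exp (-z * t)) (Ioi 0) ∧
    -- so does the one on the right
    (z ≠ 0 → IntervalIntegrable (fun t : ℝ => Complex.exp (z * t) *
        kummerULog (-α) (1 - β)
          (Complex.log c + Complex.log z + (Real.log (1 - t) : ℝ)) *
        ((1 - t : ℝ) : ℂ) ^ (-β : ℂ)) volume 0 1) ∧
    -- the identity, with `arg (c z (1 - t)) = arg c + arg z` in the argument of `U`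
    (∫ t in Ioi (0 : ℝ), ((t : ℂ) + c) ^ (α : ℂ) * (t : ℂ) ^ ((β : ℂ) - α - 1) / (1 + t) *
        Complex.exp (-z * t)) =
      expCoefficient α β c * Complex.exp z
        - Complex.Gamma (β - α) * z ^ (1 - β : ℂ) *
          ∫ t in (0 : ℝ)..1, Complex.exp (z * t) *
            kummerULog (-α) (1 - β)
              (Complex.log c + Complex.log z + (Real.log (1 - t) : ℝ)) *
            ((1 - t : ℝ) : ℂ) ^ (-β : ℂ) ∧
    -- the identity with the principal branch of `U`, where `arg (c z) = arg c + arg z`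
    (Complex.arg c + Complex.arg z ∈ Ioc (-Real.pi) Real.pi →
      (∫ t in Ioi (0 : ℝ), ((t : ℂ) + c) ^ (α : ℂ) * (t : ℂ) ^ ((β : ℂ) - α - 1) / (1 + t) *
          Complex.exp (-z * t)) =
        expCoefficient α β c * Complex.exp z
          - Complex.Gamma (β - α) * z ^ (1 - β : ℂ) *
            ∫ t in (0 : ℝ)..1, Complex.exp (z * t) *
              kummerU (-α) (1 - β) (c * z * (1 - t)) *
              ((1 - t : ℝ) : ℂ) ^ (-β : ℂ)) := by
  have hc : c ∈ slitPlane := by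
    rw [mem_slitPlane_iff_arg]
    refine ⟨fun h => ?_, norm_pos_iff.1 hc_pos⟩
    rw [h, abs_of_pos Real.pi_pos] at hc_arg
    exact lt_irrefl _ hc_arg
  have hc0 := slitPlane_ne_zero hc
  have hg : 0 < β - α := by linarith
  have hag : α + (β - α) < 1 := by linarith
  have hint : ∀ k : ℤ, α + (β - α) ≠ k := fun k hk => hβ_int k (by linarith)
  have hker : (fun t : ℝ => ((t : ℂ) + c) ^ (α : ℂ) * (t : ℂ) ^ ((β : ℂ) - α - 1) / (1 + t) *
      Complex.exp (-z * t)) = fun t : ℝ => stieltjesKernel α (β - α) c t * cexp (-z * t) := by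
    funext t
    rw [stieltjesKernel, powKernel, ofReal_sub]
  have hmain := stieltjesLaplace_eq hg hag hint hc hc_lt hz
  rw [add_sub_cancel] at hmain
  have hβ0 : (1 - β : ℂ) ≠ 0 := by
    have : (1 - β : ℝ) ≠ 0 := by linarith
    exact_mod_cast this
  rw [hker]
  have hthird : ∫ t in Ioi (0 : ℝ), stieltjesKernel α (β - α) c t * cexp (-z * t) =
      expCoefficient α β c * Complex.exp z - Complex.Gamma (β - α) * z ^ (1 - β : ℂ) *
        ∫ t in (0 : ℝ)..1, Complex.exp (z * t) * kummerULog (-α) (1 - β)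
          (Complex.log c + Complex.log z + (Real.log (1 - t) : ℝ)) *
            ((1 - t : ℝ) : ℂ) ^ (-β : ℂ) := by
    rw [← stieltjesLaplace, hmain]
    by_cases hz0 : z = 0
    -- As β < 1, the power 0^(1−β) is 0, which realises the convention that the last term vanishes
    -- at z = 0.
    · rw [hz0, zero_cpow hβ0]
      ring
    · rw [(integral_exp_mul_kummerULog hαβ hβ hc0 hz0).2]
  refine ⟨integrableOn_stieltjesKernel_mul_exp hg hag hc hz,
    fun hz0 => (integral_exp_mul_kummerULog hαβ hβ hc0 hz0).1, hthird, fun harg => ?_⟩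
  rw [hthird]
  by_cases hz0 : z = 0
  · rw [hz0, zero_cpow hβ0]
    ring
  congr 2
  refine intervalIntegral.integral_congr_ae ?_
  have h0 : ∀ᵐ t : ℝ, t ≠ 1 := by simp [ae_iff]
  filter_upwards [h0] with t h0 ht
  rw [uIoc_of_le zero_le_one] at ht
  have ht1 : 0 < 1 - t := sub_pos.2 (lt_of_le_of_ne ht.2 h0)
  -- The positive factor 1 − t does not affect the argument, so the condition on arg c + arg z is
  -- exactly what makes the principal logarithm additive.
  rw [kummerU, show c * z * (1 - t) = ((1 - t : ℝ) : ℂ) * (c * z) by push_cast; ring,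
    log_ofReal_mul ht1 (mul_ne_zero hc0 hz0), Complex.log_mul hc0 hz0 harg, add_comm]
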